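/- Let $d\ge 0$ be an integer, $m>0$, and let $\langle f,g\rangle=\int_{\mathbb R^d}\overline{f}\,g\,dx$. Let $q,p\in\mathbb R^d$, let $\mathcal A,\mathcal B$ be real symmetric $d\times d$ matrices with $\mathcal B$ positive definite, let $\phi,\delta\in\mathbb R$ and $\hbar>0$. Define $$\chi_0(x)=\exp\Big\{\tfrac{i}{\hbar}\Big[\tfrac12(x-q)^T(\mathcal A+i\mathcal B)(x-q)+p\cdot(x-q)+(\phi+i\delta)\Big]\Big\},$$ $$\mathscr L^*=\tfrac{i}{\sqrt{2\hbar}}\,\mathcal B^{-1/2}\big[(\mathcal A-i\mathcal B)(\hat x-q)-(\hat p-p)\big],\qquad \hat p=-i\hbar\,\partial/\partial x,$$ and, for multi-indices $n\in\mathbb N_0^d$, define $\chi_n$ recursively by $\chi_{n+e_j}=(n_j+1)^{-1/2}\,\mathscr L^*_j\,\chi_n$ $(1\le j\le d)$. This is well defined because the operators $\mathscr L_j^*$ commute. Let $$\mathcal N_\hbar(\mathcal B,\delta)=\sqrt{\frac{(\pi\hbar)^d}{\det\mathcal B}}\;e^{-2\delta/\hbar},\qquad \Lambda^{(n)}=\operatorname{diag}(2n_1+1,\dots,2n_d+1),\qquad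 \mathcal B^{(n)}=\mathcal B^{1/2}(\Lambda^{(n)})^{-1}\mathcal B^{1/2}.$$ Let $V\in C^3(\mathbb R^d;\mathbb R)$, and suppose that there are $C_1,C_2,M_1\in\mathbb R$ such that $C_1\le V(x)$ and $|D^\alpha V(x)|\le C_2\exp(M_1|x|^2)$ for all $x\in\mathbb R^d$ and all multi-indices $\alpha$ with $|\alpha|=3$. Let $\hat T=-\frac{\hbar^2}{2m}\Delta$, $\hat H=\hat T+V(x)$, and $$H^{(n)}=\mathcal N_\hbar(\mathcal B,\delta)\Big\{\frac{p^2}{2m}+\frac{\hbar}{4m}\operatorname{tr}\big((\mathcal B^{(n)})^{-1}(\mathcal A^2+\mathcal B^2)\big)+V(q)+\frac{\hbar}{4}\operatorname{tr}\big((\mathcal B^{(n)})^{-1}D^2V(q)\big)\Big\}.$$ Then, for every $n\in\mathbb N_0^d$ and all $q,p,\mathcal A,\mathcal B$ as above: 1. For all $\phi,\delta\in\mathbb R$ and all $\hbar>0$, $\chi_n$ and $\hat T\chi_n$ lie in $L^2(\mathbb R^d)$ and $$\langle\chi_n,\hat T\chi_n\rangle=\mathcal N_\hbar(\mathcal B,\delta)\Big\{\frac{p^2}{2m}+\frac{\hbar}{4m}\operatorname{tr}\big((\mathcal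 B^{(n)})^{-1}(\mathcal A^2+\mathcal B^2)\big)\Big\}.$$ 2. $\langle\chi_n,\hat H\chi_n\rangle=H^{(n)}+\mathcal N_\hbar(\mathcal B,\delta)\,O(\hbar^{3/2})$ as $\hbar\to0^+$, uniformly in $\phi,\delta$. That is, there exist $K\in\mathbb R$ and $\hbar_0>0$, independent of $\phi,\delta,\hbar$, such that for all $\phi,\delta\in\mathbb R$ and $0<\hbar<\hbar_0$ one has $\hat H\chi_n\in L^2(\mathbb R^d)$ and $\big|\langle\chi_n,\hat H\chi_n\rangle-H^{(n)}\big|\le K\,\mathcal N_\hbar(\mathcal B,\delta)\,\hbar^{3/2}$. -/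

import Mathlib

open MeasureTheory
open scoped MatrixOrder

namespace Semiclassical

noncomputable section

/-- Configuration space `ℝᵈ` with its Euclidean norm and Lebesgue measure. -/
abbrev Space (d : ℕ) : Type := EuclideanSpace ℝ (Fin d)

/-- The `k`-th standard basis vector of `ℝᵈ`. -/
def e {d : ℕ} (k : Fin d) : Space d := EuclideanSpace.single k (1 : ℝ)

/-- The Gaussian `exp((i/ħ)[½ (x-q)ᵀ(A+iB)(x-q) + p·(x-q) + (φ+iδ)])`. -/
def gaussian {d : ℕ} (ħ : ℝ) (q p : Space d) (A B : Matrix (Fin d) (Fin d) ℝ) (φ δ : ℝ) :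
    Space d → ℂ := fun x =>
  Complex.exp ((Complex.I / (ħ : ℂ)) *
    ((1 / 2 : ℂ) * (∑ k, ∑ l,
        ((x k - q k : ℝ) : ℂ) * ((A k l : ℂ) + Complex.I * (B k l : ℂ)) * ((x l - q l : ℝ) : ℂ))
      + ((∑ k, p k * (x k - q k) : ℝ) : ℂ)
      + ((φ : ℂ) + Complex.I * (δ : ℂ))))

/-- The momentum operator `p̂ₖ = -iħ ∂/∂xₖ`. -/
def momentumOp {d : ℕ} (ħ : ℝ) (k : Fin d) (f : Space d → ℂ) : Space d → ℂ := fun x =>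
  -Complex.I * (ħ : ℂ) * fderiv ℝ f x (e k)

/-- `B^{-1/2}`, the inverse of the positive square root of `B`. -/
def invSqrt {d : ℕ} (B : Matrix (Fin d) (Fin d) ℝ) : Matrix (Fin d) (Fin d) ℝ := (CFC.sqrt B)⁻¹

/-- The `j`-th component of the raising operator
`(i/√(2ħ)) B^{-1/2} [(A - iB)(x̂ - q) - (p̂ - p)]`. -/
def raisingOp {d : ℕ} (ħ : ℝ) (q p : Space d) (A B : Matrix (Fin d) (Fin d) ℝ) (j : Fin d)
    (f : Space d → ℂ) : Space d → ℂ := fun x =>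
  (Complex.I / ((Real.sqrt (2 * ħ) : ℝ) : ℂ)) * ∑ k, ((invSqrt B j k : ℝ) : ℂ) *
    ((∑ l, ((A k l : ℂ) - Complex.I * (B k l : ℂ)) * ((x l - q l : ℝ) : ℂ)) * f x
      - (momentumOp ħ k f x - (p k : ℂ) * f x))

/-- The wave packet `χₙ`, obtained from the Gaussian `χ₀` by applying the `j`-th raising operator
`nⱼ` times for every `j`, and dividing by `√(n₁! ⋯ n_d!)`. For symmetric `A` and `B` the raising
operators commute, and these functions satisfy the recursion
`χ_{n+eⱼ} = (nⱼ+1)^{-1/2} L*ⱼ χₙ` for every `n` and `j`: see `wavePacket_add_single`. -/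
def wavePacket {d : ℕ} (ħ : ℝ) (q p : Space d) (A B : Matrix (Fin d) (Fin d) ℝ) (φ δ : ℝ)
    (n : Fin d → ℕ) : Space d → ℂ :=
  ((∏ j, (1 / Real.sqrt ((n j).factorial : ℝ)) : ℝ) : ℂ) •
    (List.finRange d).foldr (fun j f => (raisingOp ħ q p A B j)^[n j] f)
      (gaussian ħ q p A B φ δ)

/-- The kinetic energy operator `T̂ = -(ħ²/2m) Δ`. -/
def kineticOp {d : ℕ} (ħ m : ℝ) (f : Space d → ℂ) : Space d → ℂ := fun x =>
  -((ħ ^ 2 / (2 * m) : ℝ) : ℂ) * Laplacian.laplacian f x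

/-- The Schrödinger operator `Ĥ = -(ħ²/2m) Δ + V(x)`. -/
def schrodingerOp {d : ℕ} (ħ m : ℝ) (V : Space d → ℝ) (f : Space d → ℂ) : Space d → ℂ := fun x =>
  kineticOp ħ m f x + (V x : ℂ) * f x

/-- The `L²(ℝᵈ)` inner product `⟨f, g⟩ = ∫ f̄ g`, linear in the second argument. -/
def innerL2 {d : ℕ} (f g : Space d → ℂ) : ℂ :=
  ∫ x, (starRingEnd ℂ) (f x) * g x

/-- `N_ħ(B,δ) = √((πħ)ᵈ / det B) · exp(-2δ/ħ)`. -/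
def normSq {d : ℕ} (ħ : ℝ) (B : Matrix (Fin d) (Fin d) ℝ) (δ : ℝ) : ℝ :=
  Real.sqrt ((Real.pi * ħ) ^ d / B.det) * Real.exp (-(2 * δ) / ħ)

/-- `Λ⁽ⁿ⁾ = diag(2n₁+1, …, 2n_d+1)`. -/
def Lam {d : ℕ} (n : Fin d → ℕ) : Matrix (Fin d) (Fin d) ℝ :=
  Matrix.diagonal fun j => 2 * (n j : ℝ) + 1

/-- `B⁽ⁿ⁾ = B^{1/2} (Λ⁽ⁿ⁾)⁻¹ B^{1/2}`. -/
def Bn {d : ℕ} (B : Matrix (Fin d) (Fin d) ℝ) (n : Fin d → ℕ) : Matrix (Fin d) (Fin d) ℝ :=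
  CFC.sqrt B * (Lam n)⁻¹ * CFC.sqrt B

/-- The Hessian matrix `D²V(q)`. -/
def hessian {d : ℕ} (V : Space d → ℝ) (q : Space d) : Matrix (Fin d) (Fin d) ℝ :=
  Matrix.of fun k l => iteratedFDeriv ℝ 2 V q ![e k, e l]

/-- The kinetic energy density `p²/2m + (ħ/4m) tr((B⁽ⁿ⁾)⁻¹ (A² + B²))`. -/
def kineticPart {d : ℕ} (ħ m : ℝ) (p : Space d) (A B : Matrix (Fin d) (Fin d) ℝ)
    (n : Fin d → ℕ) : ℝ :=
  ‖p‖ ^ 2 / (2 * m) + ħ / (4 * m) * ((Bn B n)⁻¹ * (A ^ 2 + B ^ 2)).trace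

/-- The semiclassical Hamiltonian `H⁽ⁿ⁾`. -/
def hamiltonian {d : ℕ} (ħ m : ℝ) (V : Space d → ℝ) (n : Fin d → ℕ) (q p : Space d)
    (A B : Matrix (Fin d) (Fin d) ℝ) (δ : ℝ) : ℝ :=
  normSq ħ B δ *
    (kineticPart ħ m p A B n + V q + ħ / 4 * ((Bn B n)⁻¹ * hessian V q).trace)

/-! The raising operators commute on smooth functions, so that the wave packets satisfy the
defining recursion in every direction. -/

/-- The multiplication part of the raising operator. -/
def raisingCoeff {d : ℕ} (ħ : ℝ) (q p : Space d) (A B : Matrix (Fin d) (Fin d) ℝ) (j : Fin d) :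
    Space d → ℂ := fun x =>
  (Complex.I / ((Real.sqrt (2 * ħ) : ℝ) : ℂ)) * ∑ k, ((invSqrt B j k : ℝ) : ℂ) *
    ((∑ l, ((A k l : ℂ) - Complex.I * (B k l : ℂ)) * ((x l - q l : ℝ) : ℂ)) + (p k : ℂ))

/-- The direction of differentiation in the raising operator. -/
def raisingDir {d : ℕ} (B : Matrix (Fin d) (Fin d) ℝ) (j : Fin d) : Space d :=
  ∑ k, invSqrt B j k • e k

theorem raisingOp_eq {d : ℕ} (ħ : ℝ) (q p : Space d) (A B : Matrix (Fin d) (Fin d) ℝ) (j : Fin d)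
    (f : Space d → ℂ) :
    raisingOp ħ q p A B j f = fun x => raisingCoeff ħ q p A B j x * f x +
      (Complex.I / ((Real.sqrt (2 * ħ) : ℝ) : ℂ) * (Complex.I * ħ)) *
        fderiv ℝ f x (raisingDir B j) := by
  funext x
  simp only [raisingOp, raisingCoeff, raisingDir, momentumOp, map_sum, map_smul, Complex.real_smul]
  rw [mul_assoc, mul_assoc, ← mul_add]
  congr 1
  rw [Finset.sum_mul, Finset.mul_sum, ← Finset.sum_add_distrib]
  refine Finset.sum_congr rfl fun k _ => ?_
  ring

theorem contDiff_raisingCoeff {d : ℕ} (ħ : ℝ) (q p : Space d) (A B : Matrix (Fin d) (Fin d) ℝ)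
    (j : Fin d) : ContDiff ℝ (⊤ : ℕ∞) (raisingCoeff ħ q p A B j) := by
  have h (l : Fin d) : ContDiff ℝ (⊤ : ℕ∞) fun x : Space d => ((x l - q l : ℝ) : ℂ) :=
    Complex.ofRealCLM.contDiff.comp
      (((EuclideanSpace.proj l : Space d →L[ℝ] ℝ).contDiff).sub contDiff_const)
  unfold raisingCoeff
  fun_prop

theorem contDiff_gaussian {d : ℕ} (ħ : ℝ) (q p : Space d) (A B : Matrix (Fin d) (Fin d) ℝ)
    (φ δ : ℝ) : ContDiff ℝ (⊤ : ℕ∞) (gaussian ħ q p A B φ δ) := by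
  have h (l : Fin d) : ContDiff ℝ (⊤ : ℕ∞) fun x : Space d => ((x l - q l : ℝ) : ℂ) :=
    Complex.ofRealCLM.contDiff.comp
      (((EuclideanSpace.proj l : Space d →L[ℝ] ℝ).contDiff).sub contDiff_const)
  have h2 : ContDiff ℝ (⊤ : ℕ∞) fun x : Space d => ((∑ k, p k * (x k - q k) : ℝ) : ℂ) := by
    simp only [Complex.ofReal_sum, Complex.ofReal_mul]
    fun_prop
  unfold gaussian
  fun_prop

theorem contDiff_raisingOp {d : ℕ} (ħ : ℝ) (q p : Space d) (A B : Matrix (Fin d) (Fin d) ℝ)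
    (j : Fin d) {f : Space d → ℂ} (hf : ContDiff ℝ (⊤ : ℕ∞) f) :
    ContDiff ℝ (⊤ : ℕ∞) (raisingOp ħ q p A B j f) := by
  rw [raisingOp_eq]
  have h1 := contDiff_raisingCoeff ħ q p A B j
  have h2 : ContDiff ℝ (⊤ : ℕ∞) fun x => fderiv ℝ f x (raisingDir B j) :=
    (hf.fderiv_right (m := (⊤ : ℕ∞)) (by simp)).clm_apply contDiff_const
  fun_prop

theorem fderiv_raisingCoeff {d : ℕ} (ħ : ℝ) (q p : Space d) (A B : Matrix (Fin d) (Fin d) ℝ)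
    (j : Fin d) (x v : Space d) :
    fderiv ℝ (raisingCoeff ħ q p A B j) x v =
      (Complex.I / ((Real.sqrt (2 * ħ) : ℝ) : ℂ)) * ∑ k, ((invSqrt B j k : ℝ) : ℂ) *
        ∑ l, ((A k l : ℂ) - Complex.I * (B k l : ℂ)) * (v l : ℂ) := by
  have h (l : Fin d) : HasFDerivAt (fun x : Space d => ((x l - q l : ℝ) : ℂ))
      (Complex.ofRealCLM ∘L (EuclideanSpace.proj l : Space d →L[ℝ] ℝ)) x :=
    Complex.ofRealCLM.hasFDerivAt.comp x
      ((EuclideanSpace.proj l : Space d →L[ℝ] ℝ).hasFDerivAt.sub_const (q l))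
  have h2 : HasFDerivAt (raisingCoeff ħ q p A B j) _ x :=
    (HasFDerivAt.fun_sum fun k (_ : k ∈ Finset.univ) =>
      ((HasFDerivAt.fun_sum fun l (_ : l ∈ Finset.univ) =>
        (h l).const_mul ((A k l : ℂ) - Complex.I * (B k l : ℂ))).add_const (p k : ℂ)).const_mul
          ((invSqrt B j k : ℝ) : ℂ)).const_mul (Complex.I / ((Real.sqrt (2 * ħ) : ℝ) : ℂ))
  rw [h2.fderiv]
  simp

theorem raisingDir_apply {d : ℕ} (B : Matrix (Fin d) (Fin d) ℝ) (j l : Fin d) :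
    raisingDir B j l = invSqrt B j l := by
  simp [raisingDir, e, Pi.single_apply]

theorem fderiv_raisingCoeff_symm {d : ℕ} (ħ : ℝ) (q p : Space d)
    {A B : Matrix (Fin d) (Fin d) ℝ} (hA : A.IsSymm) (hB : B.IsSymm) (j k : Fin d) (x : Space d) :
    fderiv ℝ (raisingCoeff ħ q p A B j) x (raisingDir B k) =
      fderiv ℝ (raisingCoeff ħ q p A B k) x (raisingDir B j) := by
  simp only [fderiv_raisingCoeff, raisingDir_apply, Finset.mul_sum]
  rw [Finset.sum_comm]
  refine Finset.sum_congr rfl fun a _ => Finset.sum_congr rfl fun b _ => ?_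
  rw [hA.apply a b, hB.apply a b]
  ring

theorem raisingOp_comm {d : ℕ} (ħ : ℝ) (q p : Space d) {A B : Matrix (Fin d) (Fin d) ℝ}
    (hA : A.IsSymm) (hB : B.IsSymm) (j k : Fin d) {f : Space d → ℂ}
    (hf : ContDiff ℝ (⊤ : ℕ∞) f) :
    raisingOp ħ q p A B j (raisingOp ħ q p A B k f) =
      raisingOp ħ q p A B k (raisingOp ħ q p A B j f) := by
  have hfd : Differentiable ℝ f := hf.differentiable (by simp)
  have hf' : Differentiable ℝ (fderiv ℝ f) :=
    (hf.fderiv_right (m := (⊤ : ℕ∞)) (by simp)).differentiable (by simp)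
  have ha (i : Fin d) : Differentiable ℝ (raisingCoeff ħ q p A B i) :=
    (contDiff_raisingCoeff ħ q p A B i).differentiable (by simp)
  have key (i : Fin d) (c : ℂ) (x v : Space d) :
      fderiv ℝ (fun x => raisingCoeff ħ q p A B i x * f x + c * fderiv ℝ f x (raisingDir B i)) x v
        = raisingCoeff ħ q p A B i x * fderiv ℝ f x v
          + f x * fderiv ℝ (raisingCoeff ħ q p A B i) x v
          + c * fderiv ℝ (fderiv ℝ f) x v (raisingDir B i) := by
    have h1 := ((ha i x).hasFDerivAt.mul (hfd x).hasFDerivAt).add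
      (((hf' x).hasFDerivAt.clm_apply (hasFDerivAt_const (raisingDir B i) x)).const_mul c)
    have h2 := h1.fderiv
    simp only [Pi.add_def, Pi.mul_def] at h2
    rw [h2]
    simp
  have hsymm (x : Space d) := (hf.contDiffAt (x := x)).isSymmSndFDerivAt
    (by simp only [minSmoothness_of_isRCLikeNormedField]; exact WithTop.coe_le_coe.mpr (le_top : (2 : ℕ∞) ≤ ⊤))
  rw [raisingOp_eq, raisingOp_eq, raisingOp_eq, raisingOp_eq]
  funext x
  rw [key, key, fderiv_raisingCoeff_symm ħ q p hA hB j k,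
    (hsymm x).eq (raisingDir B j) (raisingDir B k)]
  ring

theorem raisingOp_smul {d : ℕ} (ħ : ℝ) (q p : Space d) (A B : Matrix (Fin d) (Fin d) ℝ)
    (j : Fin d) (c : ℂ) (f : Space d → ℂ) :
    raisingOp ħ q p A B j (c • f) = c • raisingOp ħ q p A B j f := by
  rw [raisingOp_eq, raisingOp_eq]
  funext x
  rw [fderiv_const_smul_field]
  simp only [Pi.smul_apply, smul_eq_mul, smul_apply]
  ring

theorem contDiff_iterate_raisingOp {d : ℕ} (ħ : ℝ) (q p : Space d)
    (A B : Matrix (Fin d) (Fin d) ℝ) (j : Fin d) (m : ℕ) {f : Space d → ℂ}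
    (hf : ContDiff ℝ (⊤ : ℕ∞) f) : ContDiff ℝ (⊤ : ℕ∞) ((raisingOp ħ q p A B j)^[m] f) := by
  induction m with
  | zero => exact hf
  | succ m ih =>
    rw [Function.iterate_succ_apply']
    exact contDiff_raisingOp ħ q p A B j ih

theorem raisingOp_iterate_comm {d : ℕ} (ħ : ℝ) (q p : Space d) {A B : Matrix (Fin d) (Fin d) ℝ}
    (hA : A.IsSymm) (hB : B.IsSymm) (j k : Fin d) (m : ℕ) {f : Space d → ℂ}
    (hf : ContDiff ℝ (⊤ : ℕ∞) f) :
    raisingOp ħ q p A B j ((raisingOp ħ q p A B k)^[m] f) =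
      (raisingOp ħ q p A B k)^[m] (raisingOp ħ q p A B j f) := by
  induction m with
  | zero => rfl
  | succ m ih =>
    rw [Function.iterate_succ_apply', Function.iterate_succ_apply',
      raisingOp_comm ħ q p hA hB j k (contDiff_iterate_raisingOp ħ q p A B k m hf), ih]

theorem contDiff_foldr_raisingOp {d : ℕ} (ħ : ℝ) (q p : Space d)
    (A B : Matrix (Fin d) (Fin d) ℝ) (n : Fin d → ℕ) {f : Space d → ℂ}
    (hf : ContDiff ℝ (⊤ : ℕ∞) f) (L : List (Fin d)) :
    ContDiff ℝ (⊤ : ℕ∞) (L.foldr (fun j f => (raisingOp ħ q p A B j)^[n j] f) f) := by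
  induction L with
  | nil => exact hf
  | cons k L ih => exact contDiff_iterate_raisingOp ħ q p A B k (n k) ih

theorem foldr_raisingOp_add_single {d : ℕ} (ħ : ℝ) (q p : Space d)
    {A B : Matrix (Fin d) (Fin d) ℝ} (hA : A.IsSymm) (hB : B.IsSymm) (n : Fin d → ℕ) (j : Fin d)
    {f : Space d → ℂ} (hf : ContDiff ℝ (⊤ : ℕ∞) f) (L : List (Fin d)) (hL : L.Nodup) :
    L.foldr (fun i f => (raisingOp ħ q p A B i)^[(n + Pi.single j 1 : Fin d → ℕ) i] f) f =
      if j ∈ L then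
        raisingOp ħ q p A B j (L.foldr (fun i f => (raisingOp ħ q p A B i)^[n i] f) f)
      else L.foldr (fun i f => (raisingOp ħ q p A B i)^[n i] f) f := by
  induction L with
  | nil => simp
  | cons k L ih =>
    obtain ⟨hk, hL'⟩ := List.nodup_cons.mp hL
    simp only [List.foldr_cons]
    rw [ih hL']
    by_cases hjk : j = k
    · subst hjk
      simp [hk, Function.iterate_succ_apply']
    · have hkj : k ≠ j := fun h => hjk h.symm
      by_cases hjL : j ∈ L
      · simp only [hjL, if_true, List.mem_cons, or_true]
        rw [raisingOp_iterate_comm ħ q p hA hB j k _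
          (contDiff_foldr_raisingOp ħ q p A B n hf L)]
        simp [hkj]
      · simp [hjL, hjk, hkj]

theorem wavePacket_zero {d : ℕ} (ħ : ℝ) (q p : Space d) (A B : Matrix (Fin d) (Fin d) ℝ)
    (φ δ : ℝ) : wavePacket ħ q p A B φ δ 0 = gaussian ħ q p A B φ δ := by
  simp [wavePacket]

theorem wavePacket_add_single {d : ℕ} (ħ : ℝ) (q p : Space d) {A B : Matrix (Fin d) (Fin d) ℝ}
    (hA : A.IsSymm) (hB : B.IsSymm) (φ δ : ℝ) (n : Fin d → ℕ) (j : Fin d) :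
    wavePacket ħ q p A B φ δ (n + Pi.single j 1 : Fin d → ℕ) =
      ((1 / Real.sqrt ((n j : ℝ) + 1) : ℝ) : ℂ) •
        raisingOp ħ q p A B j (wavePacket ħ q p A B φ δ n) := by
  unfold wavePacket
  rw [raisingOp_smul, smul_smul, ← Complex.ofReal_mul,
    foldr_raisingOp_add_single ħ q p hA hB n j (contDiff_gaussian ħ q p A B φ δ) _
      (List.nodup_finRange d), if_pos (List.mem_finRange j)]
  congr 2
  rw [← Finset.mul_prod_erase _ _ (Finset.mem_univ j),
    ← Finset.mul_prod_erase _ (fun i => 1 / Real.sqrt ((n i).factorial : ℝ)) (Finset.mem_univ j),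
    ← mul_assoc]
  congr 1
  · simp [Nat.factorial_succ, mul_comm]
  · refine Finset.prod_congr rfl fun i hi => ?_
    simp [(Finset.mem_erase.mp hi).1]

end

end Semiclassical

namespace Semiclassical

noncomputable section

/-! ### Hermite polynomials and the one-dimensional Gaussian -/

/-! The normalized coordinates t = (2/ħ)^{1/2} B^{1/2}(x - q) turn |χ₀|² into e^{-2δ/ħ}
exp(-|t|²/2), so expectations become N_ħ(B,δ) times standard Gaussian means
(`integral_mul_norm_gaussian_sq`). On P(t)χ₀ the j-th raising operator acts by P ↦ t_j P - ∂_j P,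
the Hermite recursion; hence χₙ = ∏ (n_j!)^{-1/2} He_{n_j}(t_j) χ₀ (`wavePacket_eq`).

Kinetic energy: integrating by parts once gives (1/2m) ∑ ‖p̂_k χₙ‖². For real P the prefactor of
p̂_k(Pχ₀) splits into a real part, made of p and A, and an imaginary part, made of B and the
derivative of P. The first is linear in the functions t_j He and the second in (t_j - 2∂_j) He. In
both families distinct indices are orthogonal and the normalized mean square is 2n_j + 1; these
weights assemble into the trace with (B⁽ⁿ⁾)⁻¹, and the formula is exact.

Potential energy: V is replaced by its second-order Taylor polynomial at q. The linear term has mean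
zero and the quadratic one gives the Hessian trace. Since |x - q| is of order ħ^{1/2}|t|, the
remainder is at most a constant times ħ^{3/2} |t|³ exp(O(ħ)|t|²). For small ħ this is dominated by
ħ^{3/2} exp(|t|²/8), which is integrable against the Hermite density; its mean does not involve ħ, φ
or δ, whence the uniformity (`potential_expectation`). -/

open Polynomial in
/-- The Gaussian mean `(2π)^{-1/2} ∫ P(t) exp(-t²/2) dt` of a polynomial. -/
def polyMean (P : ℝ[X]) : ℝ := (Real.sqrt (2 * Real.pi))⁻¹ * ∫ t, P.eval t * Real.exp (-t ^ 2 / 2)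

open Polynomial in
/-- The `n`-th (probabilists') Hermite polynomial with real coefficients. -/
def hermiteR (n : ℕ) : ℝ[X] := (hermite n).map (Int.castRingHom ℝ)

section OneDim

open Polynomial

theorem integrable_polynomial_mul_exp (P : ℝ[X]) {b : ℝ} (hb : 0 < b) :
    Integrable fun t : ℝ => P.eval t * Real.exp (-b * t ^ 2) := by
  induction P using Polynomial.induction_on' with
  | add P Q hP hQ =>
    simp only [eval_add, add_mul]
    exact hP.add hQ
  | monomial k a =>
    have h := (integrable_rpow_mul_exp_neg_mul_sq hb
      (s := (k : ℝ)) (by linarith [k.cast_nonneg (α := ℝ)])).const_mul a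
    refine h.congr (Filter.Eventually.of_forall fun t => ?_)
    simp only [eval_monomial, Real.rpow_natCast]
    rw [← mul_assoc]

theorem integrable_polynomial_mul_gaussian (P : ℝ[X]) :
    Integrable fun t : ℝ => P.eval t * Real.exp (-t ^ 2 / 2) := by
  refine (integrable_polynomial_mul_exp P (b := 1 / 2) (by norm_num)).congr
    (Filter.Eventually.of_forall fun t => ?_)
  ring_nf

theorem polyMean_add (P Q : ℝ[X]) : polyMean (P + Q) = polyMean P + polyMean Q := by
  simp only [polyMean, eval_add, add_mul]
  rw [integral_add (integrable_polynomial_mul_gaussian P) (integrable_polynomial_mul_gaussian Q),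
    mul_add]

theorem polyMean_C_mul (c : ℝ) (P : ℝ[X]) : polyMean (C c * P) = c * polyMean P := by
  simp only [polyMean, eval_mul, eval_C, mul_assoc, integral_const_mul]
  ring

theorem polyMean_sub (P Q : ℝ[X]) : polyMean (P - Q) = polyMean P - polyMean Q := by
  have h := polyMean_add P (C (-1) * Q)
  rw [polyMean_C_mul] at h
  rw [show P - Q = P + C (-1) * Q by rw [C_neg, C_1]; ring, h]
  ring

theorem polyMean_zero : polyMean 0 = 0 := by simp [polyMean]

theorem polyMean_one : polyMean 1 = 1 := by
  have h : ∫ t : ℝ, Real.exp (-t ^ 2 / 2) = Real.sqrt (2 * Real.pi) := by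
    have h := integral_gaussian (1 / 2)
    rw [show Real.pi / (1 / 2) = 2 * Real.pi by ring] at h
    rw [← h]
    congr 1
    funext t
    congr 1
    ring
  have h0 : Real.sqrt (2 * Real.pi) ≠ 0 := by positivity
  simp only [polyMean, eval_one, one_mul, h]
  exact inv_mul_cancel₀ h0

/-- Gaussian integration by parts. -/
theorem polyMean_X_mul (P : ℝ[X]) : polyMean (X * P) = polyMean (derivative P) := by
  have hd (t : ℝ) : HasDerivAt (fun t : ℝ => P.eval t * Real.exp (-t ^ 2 / 2))
      ((derivative P - X * P).eval t * Real.exp (-t ^ 2 / 2)) t := by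
    have h1 : HasDerivAt (fun t : ℝ => -t ^ 2 / 2) (-t) t := by
      refine ((hasDerivAt_pow 2 t).neg.div_const 2).congr_deriv ?_
      ring
    refine ((P.hasDerivAt t).mul h1.exp).congr_deriv ?_
    rw [eval_sub, eval_mul, eval_X]
    ring
  have h := integral_eq_zero_of_hasDerivAt_of_integrable hd
    (integrable_polynomial_mul_gaussian _) (integrable_polynomial_mul_gaussian _)
  have h2 : polyMean (derivative P - X * P) = 0 := by rw [polyMean, h, mul_zero]
  rw [polyMean_sub] at h2
  linarith

theorem hermiteR_zero : hermiteR 0 = 1 := by simp [hermiteR]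

theorem hermiteR_succ (n : ℕ) :
    hermiteR (n + 1) = X * hermiteR n - derivative (hermiteR n) := by
  simp [hermiteR, hermite_succ, derivative_map]

theorem derivative_hermiteR_succ (n : ℕ) :
    derivative (hermiteR (n + 1)) = C ((n : ℝ) + 1) * hermiteR n := by
  induction n with
  | zero => simp [hermiteR_succ, hermiteR_zero]
  | succ n ih =>
    rw [hermiteR_succ (n + 1), derivative_sub, derivative_mul, derivative_X, ih,
      derivative_mul, derivative_C, hermiteR_succ n]
    push_cast
    simp only [C_add, C_1]
    ring

/-- The operator X - d/dX is adjoint to d/dX for the Gaussian mean, so one Hermite index can be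
traded for a derivative of the other factor. The orthogonality relations and norms below rest on
this. -/
theorem polyMean_hermiteR_succ_mul (n : ℕ) (P : ℝ[X]) :
    polyMean (hermiteR (n + 1) * P) = polyMean (hermiteR n * derivative P) := by
  have h := polyMean_X_mul (hermiteR n * P)
  rw [derivative_mul, polyMean_add] at h
  rw [hermiteR_succ, sub_mul, polyMean_sub, mul_assoc, h]
  ring

theorem polyMean_hermiteR_sq (n : ℕ) :
    polyMean (hermiteR n * hermiteR n) = (n.factorial : ℝ) := by
  induction n with
  | zero => simp [hermiteR_zero, polyMean_one]
  | succ n ih =>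
    rw [polyMean_hermiteR_succ_mul, derivative_hermiteR_succ, mul_left_comm, polyMean_C_mul, ih,
      Nat.factorial_succ]
    push_cast
    ring

theorem polyMean_hermiteR_mul_derivative (n : ℕ) :
    polyMean (hermiteR n * derivative (hermiteR n)) = 0 := by
  induction n with
  | zero => simp [hermiteR_zero, polyMean_zero]
  | succ n ih =>
    rw [derivative_hermiteR_succ, mul_left_comm, polyMean_C_mul, polyMean_hermiteR_succ_mul, ih,
      mul_zero]

theorem polyMean_hermiteR_mul_derivative_derivative (n : ℕ) :
    polyMean (hermiteR n * derivative (derivative (hermiteR n))) = 0 := by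
  cases n with
  | zero => simp [hermiteR_zero, polyMean_zero]
  | succ n =>
    rw [polyMean_hermiteR_succ_mul, derivative_hermiteR_succ]
    induction n with
    | zero => simp [hermiteR_zero, polyMean_zero]
    | succ n ih =>
      simp only [derivative_C_mul] at ih ⊢
      rw [polyMean_hermiteR_succ_mul, derivative_hermiteR_succ]
      simp only [derivative_C_mul]
      rw [mul_left_comm, polyMean_C_mul, mul_left_comm, polyMean_C_mul]
      rw [mul_left_comm, polyMean_C_mul] at ih
      -- By now `ih` is (n+1) times the mean of He_n He_n', so the nonzero factor can be cancelled.
      have h1 : ((n : ℝ) + 1) ≠ 0 := by positivity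
      simp [(mul_eq_zero.mp ih).resolve_left h1]

theorem polyMean_derivative_hermiteR_sq (n : ℕ) :
    polyMean (derivative (hermiteR n) * derivative (hermiteR n)) = n * (n.factorial : ℝ) := by
  cases n with
  | zero => simp [hermiteR_zero, polyMean_zero]
  | succ n =>
    rw [derivative_hermiteR_succ, mul_mul_mul_comm, ← C_mul, polyMean_C_mul, polyMean_hermiteR_sq,
      Nat.factorial_succ]
    push_cast
    ring

theorem polyMean_X_mul_hermiteR_mul_derivative (n : ℕ) :
    polyMean (X * hermiteR n * derivative (hermiteR n)) = n * (n.factorial : ℝ) := by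
  rw [show X * hermiteR n = hermiteR (n + 1) + derivative (hermiteR n) by rw [hermiteR_succ]; ring,
    add_mul, polyMean_add, polyMean_hermiteR_succ_mul, polyMean_hermiteR_mul_derivative_derivative,
    polyMean_derivative_hermiteR_sq, zero_add]

theorem polyMean_X_mul_hermiteR_mul (n : ℕ) :
    polyMean (X * hermiteR n * hermiteR n) = 0 := by
  rw [mul_assoc, polyMean_X_mul, derivative_mul, polyMean_add, mul_comm,
    polyMean_hermiteR_mul_derivative, add_zero]

/-- Integrating one factor X by parts leaves the mean of He_n² + 2 X He_n He_n', that is n! + 2n·n!.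
This is the source of the entries of `Lam`. -/
theorem polyMean_X_mul_hermiteR_sq (n : ℕ) :
    polyMean ((X * hermiteR n) * (X * hermiteR n)) = (2 * n + 1) * (n.factorial : ℝ) := by
  rw [mul_assoc, polyMean_X_mul, show derivative (hermiteR n * (X * hermiteR n)) =
      hermiteR n * hermiteR n + C 2 * (X * hermiteR n * derivative (hermiteR n)) by
    rw [derivative_mul, derivative_mul, derivative_X, show (C 2 : ℝ[X]) = 2 from rfl]; ring,
    polyMean_add, polyMean_C_mul, polyMean_hermiteR_sq, polyMean_X_mul_hermiteR_mul_derivative]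
  ring

/-- Since d/dt (P e^{-t²/4}) = -½ ((t - 2 d/dt)P) e^{-t²/4}, the operator X - 2 d/dX represents
momentum. Its mean and mean square in a Hermite state agree with those of X, as for the harmonic
oscillator. -/
theorem polyMean_ladder_mul_hermiteR (n : ℕ) :
    polyMean ((X * hermiteR n - C 2 * derivative (hermiteR n)) * hermiteR n) = 0 := by
  rw [sub_mul, polyMean_sub, polyMean_X_mul_hermiteR_mul, mul_assoc, polyMean_C_mul,
    mul_comm (derivative _), polyMean_hermiteR_mul_derivative]
  ring

theorem polyMean_ladder_sq (n : ℕ) :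
    polyMean ((X * hermiteR n - C 2 * derivative (hermiteR n)) *
      (X * hermiteR n - C 2 * derivative (hermiteR n))) = (2 * n + 1) * (n.factorial : ℝ) := by
  rw [show (X * hermiteR n - C 2 * derivative (hermiteR n)) *
      (X * hermiteR n - C 2 * derivative (hermiteR n)) =
      (X * hermiteR n) * (X * hermiteR n) - C 4 * (X * hermiteR n * derivative (hermiteR n)) +
        C 4 * (derivative (hermiteR n) * derivative (hermiteR n)) by
    rw [show (C 4 : ℝ[X]) = C 2 * C 2 by rw [← C_mul]; norm_num,
      show (C 2 : ℝ[X]) = 2 from rfl]; ring,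
    polyMean_add, polyMean_sub, polyMean_C_mul, polyMean_C_mul, polyMean_X_mul_hermiteR_sq,
    polyMean_X_mul_hermiteR_mul_derivative, polyMean_derivative_hermiteR_sq]
  ring

end OneDim

/-! ### The standard Gaussian on `ℝᵈ` -/

/-- The Gaussian weight `exp(-|t|²/2)`. -/
def weight {d : ℕ} (t : Fin d → ℝ) : ℝ := Real.exp (-(∑ j, t j ^ 2) / 2)

/-- The Gaussian mean `(2π)^{-d/2} ∫ F(t) exp(-|t|²/2) dt`. -/
def gaussMean {d : ℕ} (F : (Fin d → ℝ) → ℝ) : ℝ :=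
  (Real.sqrt (2 * Real.pi))⁻¹ ^ d * ∫ t, F t * weight t

open Polynomial in
/-- The product of polynomials in separate variables. -/
def prodEval {d : ℕ} (g : Fin d → ℝ[X]) (t : Fin d → ℝ) : ℝ := ∏ i, (g i).eval (t i)

theorem weight_eq_prod {d : ℕ} (t : Fin d → ℝ) : weight t = ∏ j, Real.exp (-t j ^ 2 / 2) := by
  rw [weight, ← Real.exp_sum, ← Finset.sum_div, Finset.sum_neg_distrib]

theorem continuous_weight {d : ℕ} : Continuous (weight : (Fin d → ℝ) → ℝ) := by
  unfold weight
  fun_prop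

theorem weight_pos {d : ℕ} (t : Fin d → ℝ) : 0 < weight t := Real.exp_pos _

/-- A continuous function of growth at most `exp(a|t|²)`, `a < 1/2`, is integrable against the
Gaussian weight. -/
theorem integrable_mul_weight {d : ℕ} {F : (Fin d → ℝ) → ℝ} (hF : Continuous F) {c a : ℝ}
    (ha : a < 1 / 2) (hb : ∀ t, |F t| ≤ c * Real.exp (a * ∑ j, t j ^ 2)) :
    Integrable fun t => F t * weight t := by
  have h1 : Integrable fun s : ℝ => Real.exp (-(1 / 2 - a) * s ^ 2) :=
    integrable_exp_neg_mul_sq (by linarith)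
  have h2 : Integrable fun t : Fin d → ℝ => c * ∏ j, Real.exp (-(1 / 2 - a) * t j ^ 2) :=
    (Integrable.fintype_prod (f := fun _ : Fin d => fun s : ℝ => Real.exp (-(1 / 2 - a) * s ^ 2))
      (fun _ => h1)).const_mul c
  refine h2.mono' (hF.mul continuous_weight).aestronglyMeasurable
    (Filter.Eventually.of_forall fun t => ?_)
  rw [Real.norm_eq_abs, abs_mul, abs_of_pos (weight_pos t), ← Real.exp_sum, ← Finset.mul_sum]
  refine (mul_le_mul_of_nonneg_right (hb t) (weight_pos t).le).trans (le_of_eq ?_)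
  rw [weight, mul_assoc, ← Real.exp_add]
  congr 2
  ring

theorem prodEval_mul {d : ℕ} (g h : Fin d → Polynomial ℝ) (t : Fin d → ℝ) :
    prodEval (g * h) t = prodEval g t * prodEval h t := by
  simp [prodEval, Finset.prod_mul_distrib]

theorem prodEval_mul_weight {d : ℕ} (g : Fin d → Polynomial ℝ) (t : Fin d → ℝ) :
    prodEval g t * weight t = ∏ i, ((g i).eval (t i) * Real.exp (-t i ^ 2 / 2)) := by
  rw [weight_eq_prod, prodEval, Finset.prod_mul_distrib]

theorem integrable_prodEval_mul_weight {d : ℕ} (g : Fin d → Polynomial ℝ) :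
    Integrable fun t => prodEval g t * weight t := by
  simp only [prodEval_mul_weight]
  exact Integrable.fintype_prod (f := fun i => fun s : ℝ => (g i).eval s * Real.exp (-s ^ 2 / 2))
    fun i => integrable_polynomial_mul_gaussian (g i)

theorem gaussMean_prodEval {d : ℕ} (g : Fin d → Polynomial ℝ) :
    gaussMean (prodEval g) = ∏ i, polyMean (g i) := by
  simp only [gaussMean, prodEval_mul_weight, polyMean]
  rw [integral_fintype_prod_volume_eq_prod
    (fun i => fun s : ℝ => (g i).eval s * Real.exp (-s ^ 2 / 2)), Finset.prod_mul_distrib]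
  simp

theorem gaussMean_const_mul {d : ℕ} (c : ℝ) (F : (Fin d → ℝ) → ℝ) :
    gaussMean (fun t => c * F t) = c * gaussMean F := by
  simp only [gaussMean, mul_assoc, integral_const_mul]
  ring

theorem gaussMean_add {d : ℕ} {F G : (Fin d → ℝ) → ℝ} (hF : Integrable fun t => F t * weight t)
    (hG : Integrable fun t => G t * weight t) :
    gaussMean (fun t => F t + G t) = gaussMean F + gaussMean G := by
  simp only [gaussMean, add_mul]
  rw [integral_add hF hG, mul_add]

theorem gaussMean_sum {d : ℕ} {ι : Type*} (s : Finset ι) {F : ι → (Fin d → ℝ) → ℝ}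
    (hF : ∀ i ∈ s, Integrable fun t => F i t * weight t) :
    gaussMean (fun t => ∑ i ∈ s, F i t) = ∑ i ∈ s, gaussMean (F i) := by
  simp only [gaussMean, Finset.sum_mul]
  rw [integral_finsetSum s hF, Finset.mul_sum]

/-! ### Orthogonality of one-factor modifications of a product state -/

section Orthogonality

variable {d : ℕ} {h r : Fin d → Polynomial ℝ} {lam : Fin d → ℝ}

theorem gaussMean_prodEval_update_mul (h0 : ∀ i, polyMean (r i * h i) = 0) (j : Fin d) :
    gaussMean (fun t => prodEval (Function.update h j (r j)) t * prodEval h t) = 0 := by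
  simp only [← prodEval_mul]
  rw [gaussMean_prodEval]
  exact Finset.prod_eq_zero (Finset.mem_univ j) (by simpa using h0 j)

/-- The mean factorizes over coordinates. For i ≠ j the factor at i is the mean of r_i h_i, which
vanishes; for i = j only that factor differs from the squared norm of h. -/
theorem gaussMean_prodEval_update_mul_update (h0 : ∀ i, polyMean (r i * h i) = 0)
    (h1 : ∀ i, polyMean (r i * r i) = lam i * polyMean (h i * h i)) (i j : Fin d) :
    gaussMean (fun t => prodEval (Function.update h i (r i)) t *
        prodEval (Function.update h j (r j)) t) =
      if i = j then lam j * ∏ k, polyMean (h k * h k) else 0 := by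
  simp only [← prodEval_mul]
  rw [gaussMean_prodEval]
  split_ifs with hij
  · subst hij
    rw [← Finset.mul_prod_erase _ _ (Finset.mem_univ i),
      ← Finset.mul_prod_erase Finset.univ (fun k => polyMean (h k * h k)) (Finset.mem_univ i),
      ← mul_assoc, ← h1]
    congr 1
    · simp
    · refine Finset.prod_congr rfl fun k hk => ?_
      simp [(Finset.mem_erase.mp hk).1]
  · exact Finset.prod_eq_zero (Finset.mem_univ i) (by simpa [hij] using h0 i)

/-- Keeping `r` abstract lets one computation serve both position, r = X·He, and momentum, r = X·He
- 2 He'. -/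
theorem gaussMean_quadratic (h0 : ∀ i, polyMean (r i * h i) = 0)
    (h1 : ∀ i, polyMean (r i * r i) = lam i * polyMean (h i * h i)) (a : Fin d → Fin d → ℝ) :
    gaussMean (fun t => ∑ i, ∑ j, a i j * (prodEval (Function.update h i (r i)) t *
        prodEval (Function.update h j (r j)) t)) =
      (∑ j, a j j * lam j) * ∏ k, polyMean (h k * h k) := by
  have hint (i j : Fin d) : Integrable fun t => (a i j *
      (prodEval (Function.update h i (r i)) t * prodEval (Function.update h j (r j)) t)) *
        weight t := by
    simp only [← prodEval_mul, mul_assoc]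
    exact (integrable_prodEval_mul_weight _).const_mul _
  rw [gaussMean_sum _ fun i _ => by
    simp only [Finset.sum_mul]; exact integrable_finsetSum _ fun j _ => hint i j]
  simp only [gaussMean_sum _ fun j _ => hint _ j, gaussMean_const_mul,
    gaussMean_prodEval_update_mul_update h0 h1]
  simp [Finset.sum_mul, mul_assoc]

theorem gaussMean_linear (h0 : ∀ i, polyMean (r i * h i) = 0) (a : Fin d → ℝ) :
    gaussMean (fun t => ∑ j, a j * (prodEval (Function.update h j (r j)) t * prodEval h t)) =
      0 := by
  rw [gaussMean_sum _ fun j _ => by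
    simp only [← prodEval_mul, mul_assoc]
    exact (integrable_prodEval_mul_weight _).const_mul _]
  simp [gaussMean_const_mul, gaussMean_prodEval_update_mul h0]

theorem gaussMean_prodEval_sq :
    gaussMean (fun t => prodEval h t * prodEval h t) = ∏ k, polyMean (h k * h k) := by
  simp only [← prodEval_mul]
  rw [gaussMean_prodEval]
  rfl

end Orthogonality

/-! ### Normalized coordinates -/

section SquareRoot

variable {d : ℕ} {B : Matrix (Fin d) (Fin d) ℝ}

theorem isSymm_of_posDef (hB : B.PosDef) : B.IsSymm := by
  simpa [Matrix.IsHermitian, Matrix.IsSymm, Matrix.conjTranspose_eq_transpose_of_trivial]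
    using hB.isHermitian

theorem sqrt_mul_sqrt (hB : B.PosDef) : CFC.sqrt B * CFC.sqrt B = B :=
  CFC.sqrt_mul_sqrt_self B hB.posSemidef.nonneg

theorem sqrt_isSymm (B : Matrix (Fin d) (Fin d) ℝ) : (CFC.sqrt B).IsSymm := by
  have h := (Matrix.nonneg_iff_posSemidef.mp (CFC.sqrt_nonneg B)).isHermitian
  simpa [Matrix.IsHermitian, Matrix.IsSymm, Matrix.conjTranspose_eq_transpose_of_trivial] using h

theorem invSqrt_isSymm (B : Matrix (Fin d) (Fin d) ℝ) : (invSqrt B).IsSymm := by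
  rw [Matrix.IsSymm, invSqrt, Matrix.transpose_nonsing_inv, (sqrt_isSymm B).eq]

theorem det_sqrt_sq (hB : B.PosDef) : (CFC.sqrt B).det * (CFC.sqrt B).det = B.det := by
  rw [← Matrix.det_mul, sqrt_mul_sqrt hB]

theorem det_sqrt_ne_zero (hB : B.PosDef) : (CFC.sqrt B).det ≠ 0 := fun h => by
  have h1 := det_sqrt_sq hB
  rw [h, mul_zero] at h1
  exact hB.det_pos.ne h1

theorem abs_det_sqrt (hB : B.PosDef) : |(CFC.sqrt B).det| = Real.sqrt B.det := by
  rw [← det_sqrt_sq hB, Real.sqrt_mul_self_eq_abs]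

theorem invSqrt_mul_sqrt (hB : B.PosDef) : invSqrt B * CFC.sqrt B = 1 :=
  Matrix.nonsing_inv_mul _ (isUnit_iff_ne_zero.mpr (det_sqrt_ne_zero hB))

theorem sqrt_mul_invSqrt (hB : B.PosDef) : CFC.sqrt B * invSqrt B = 1 :=
  Matrix.mul_nonsing_inv _ (isUnit_iff_ne_zero.mpr (det_sqrt_ne_zero hB))

theorem mul_invSqrt (hB : B.PosDef) : B * invSqrt B = CFC.sqrt B := by
  have h := congrArg (· * invSqrt B) (sqrt_mul_sqrt hB)
  simp only [mul_assoc, sqrt_mul_invSqrt hB, mul_one] at h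
  exact h.symm

theorem invSqrt_mul (hB : B.PosDef) : invSqrt B * B = CFC.sqrt B := by
  have h := congrArg (invSqrt B * ·) (sqrt_mul_sqrt hB)
  simp only [← mul_assoc, invSqrt_mul_sqrt hB, one_mul] at h
  exact h.symm

end SquareRoot

open scoped Matrix

/-- The normalized coordinates `t = (2/ħ)^{1/2} B^{1/2} (x - q)`. -/
def coord {d : ℕ} (ħ : ℝ) (q : Space d) (B : Matrix (Fin d) (Fin d) ℝ) (x : Space d) : Fin d → ℝ :=
  fun j => Real.sqrt (2 / ħ) * ∑ k, CFC.sqrt B j k * (x k - q k)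

section Coord

variable {d : ℕ} {ħ : ℝ} {q : Space d} {B : Matrix (Fin d) (Fin d) ℝ}

theorem coord_eq_mulVec (ħ : ℝ) (q : Space d) (B : Matrix (Fin d) (Fin d) ℝ) (x : Space d) :
    coord ħ q B x =
      (Real.sqrt (2 / ħ) • CFC.sqrt B) *ᵥ (WithLp.ofLp x - WithLp.ofLp q) := by
  funext j
  simp [coord, Matrix.mulVec, dotProduct, Finset.mul_sum, mul_assoc]

theorem continuous_coord (ħ : ℝ) (q : Space d) (B : Matrix (Fin d) (Fin d) ℝ) :
    Continuous (coord ħ q B) := by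
  unfold coord
  fun_prop

theorem sqrt_half_mul_sqrt (hħ : 0 < ħ) : Real.sqrt (ħ / 2) * Real.sqrt (2 / ħ) = 1 := by
  rw [← Real.sqrt_mul (by positivity)]
  rw [show ħ / 2 * (2 / ħ) = 1 by field_simp]
  exact Real.sqrt_one

theorem sub_eq_sum_coord (hB : B.PosDef) (hħ : 0 < ħ) (q x : Space d) (k : Fin d) :
    x k - q k = Real.sqrt (ħ / 2) * ∑ j, invSqrt B k j * coord ħ q B x j := by
  have h : invSqrt B *ᵥ coord ħ q B x = Real.sqrt (2 / ħ) • (WithLp.ofLp x - WithLp.ofLp q) := by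
    rw [coord_eq_mulVec, Matrix.mulVec_mulVec, Matrix.mul_smul, invSqrt_mul_sqrt hB,
      Matrix.smul_mulVec, Matrix.one_mulVec]
  have h1 := congrFun h k
  simp only [Matrix.mulVec, dotProduct, Pi.smul_apply, Pi.sub_apply, smul_eq_mul] at h1
  rw [h1, ← mul_assoc, sqrt_half_mul_sqrt hħ, one_mul]

theorem injective_coord (hB : B.PosDef) (hħ : 0 < ħ) (q : Space d) :
    Function.Injective (coord ħ q B) := fun x y hxy => by
  ext k
  have h1 := sub_eq_sum_coord hB hħ q x k
  have h2 := sub_eq_sum_coord hB hħ q y k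
  rw [hxy, ← h2] at h1
  linarith

theorem measurableEmbedding_coord (hB : B.PosDef) (hħ : 0 < ħ) (q : Space d) :
    MeasurableEmbedding (coord ħ q B) :=
  (continuous_coord ħ q B).measurableEmbedding (injective_coord hB hħ q)

/-- Only the linear factor of `coord` distorts volume: forgetting the Euclidean norm and translating
by q preserve Lebesgue measure, and |det ((2/ħ)^{1/2} B^{1/2})| = (2/ħ)^{d/2} (det B)^{1/2}. -/
theorem map_coord_volume (hB : B.PosDef) (hħ : 0 < ħ) (q : Space d) :
    Measure.map (coord ħ q B) volume =
      ENNReal.ofReal ((Real.sqrt (2 / ħ) ^ d * Real.sqrt B.det)⁻¹) • volume := by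
  set M : Matrix (Fin d) (Fin d) ℝ := Real.sqrt (2 / ħ) • CFC.sqrt B
  have hs : 0 < Real.sqrt (2 / ħ) := by positivity
  have hdet : M.det = Real.sqrt (2 / ħ) ^ d * (CFC.sqrt B).det := by
    simp [M]
  have hM : M.det ≠ 0 := by
    rw [hdet]
    exact mul_ne_zero (by positivity) (det_sqrt_ne_zero hB)
  have h1 : coord ħ q B = Matrix.toLin' M ∘ (fun y => y - WithLp.ofLp q) ∘ WithLp.ofLp := by
    funext x
    exact coord_eq_mulVec ħ q B x
  have hm : Measurable (Matrix.toLin' M) :=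
    (LinearMap.continuous_of_finiteDimensional (Matrix.toLin' M)).measurable
  have hs2 : Measurable (fun y : Fin d → ℝ => y - WithLp.ofLp q) := measurable_id.sub_const _
  have hp := PiLp.volume_preserving_ofLp (Fin d)
  rw [h1, ← Measure.map_map hm (hs2.comp hp.measurable), ← Measure.map_map hs2 hp.measurable,
    hp.map_eq, (measurePreserving_sub_right volume (WithLp.ofLp q)).map_eq,
    Real.map_matrix_volume_pi_eq_smul_volume_pi hM, hdet, abs_inv, abs_mul, abs_det_sqrt hB,
    abs_of_pos (pow_pos hs d)]

theorem integral_comp_coord {E : Type*} [NormedAddCommGroup E] [NormedSpace ℝ E]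
    (hB : B.PosDef) (hħ : 0 < ħ) (q : Space d) (F : (Fin d → ℝ) → E) :
    ∫ x, F (coord ħ q B x) = (Real.sqrt (2 / ħ) ^ d * Real.sqrt B.det)⁻¹ • ∫ t, F t := by
  rw [← (measurableEmbedding_coord hB hħ q).integral_map F, map_coord_volume hB hħ q,
    integral_smul_measure, ENNReal.toReal_ofReal (by positivity)]

theorem Integrable.comp_coord {E : Type*} [NormedAddCommGroup E]
    (hB : B.PosDef) (hħ : 0 < ħ) (q : Space d) {F : (Fin d → ℝ) → E} (hF : Integrable F) :
    Integrable fun x => F (coord ħ q B x) := by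
  have h : Integrable F (Measure.map (coord ħ q B) volume) := by
    rw [map_coord_volume hB hħ q]
    exact hF.smul_measure ENNReal.ofReal_ne_top
  exact (measurableEmbedding_coord hB hħ q).integrable_map_iff.mp h

theorem sum_coord_sq (hB : B.PosDef) (hħ : 0 < ħ) (q x : Space d) :
    ∑ j, coord ħ q B x j ^ 2 =
      2 / ħ * ∑ k, ∑ l, (x k - q k) * B k l * (x l - q l) := by
  set u : Fin d → ℝ := WithLp.ofLp x - WithLp.ofLp q with hu
  have h1 : ∑ j, coord ħ q B x j ^ 2 = coord ħ q B x ⬝ᵥ coord ħ q B x := by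
    simp [dotProduct, sq]
  have h2 : ∑ k, ∑ l, (x k - q k) * B k l * (x l - q l) = u ⬝ᵥ (B *ᵥ u) := by
    simp [dotProduct, Matrix.mulVec, Finset.mul_sum, mul_assoc, u]
  rw [h1, h2, coord_eq_mulVec, Matrix.smul_mulVec, smul_dotProduct, dotProduct_smul, ← hu,
    Matrix.dotProduct_mulVec, Matrix.vecMul_mulVec, (sqrt_isSymm B).eq, sqrt_mul_sqrt hB,
    smul_eq_mul, smul_eq_mul, ← mul_assoc, Real.mul_self_sqrt (by positivity),
    Matrix.dotProduct_mulVec]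

/-- The constant `κ` in `‖x - q‖² ≤ (ħ/2) κ |t|²`. -/
def spread (B : Matrix (Fin d) (Fin d) ℝ) : ℝ := ∑ k, ∑ j, invSqrt B k j ^ 2

theorem spread_nonneg (B : Matrix (Fin d) (Fin d) ℝ) : 0 ≤ spread B :=
  Finset.sum_nonneg fun _ _ => Finset.sum_nonneg fun _ _ => sq_nonneg _

/-- Cauchy–Schwarz in each row of x - q = (ħ/2)^{1/2} B^{-1/2} t; `spread B` is the squared
Frobenius norm of B^{-1/2}. This inequality converts powers of |x - q| into powers of ħ^{1/2}. -/
theorem norm_sub_sq_le (hB : B.PosDef) (hħ : 0 < ħ) (q x : Space d) :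
    ‖x - q‖ ^ 2 ≤ ħ / 2 * spread B * ∑ j, coord ħ q B x j ^ 2 := by
  rw [EuclideanSpace.real_norm_sq_eq]
  rw [spread, mul_assoc, Finset.sum_mul, Finset.mul_sum]
  refine Finset.sum_le_sum fun k _ => ?_
  rw [PiLp.sub_apply, sub_eq_sum_coord hB hħ, mul_pow, Real.sq_sqrt (by positivity)]
  exact mul_le_mul_of_nonneg_left (Finset.sum_mul_sq_le_sq_mul_sq _ _ _) (by positivity)

end Coord

/-! ### The modulus of the Gaussian and its normalization -/

section Gaussian

variable {d : ℕ} {ħ : ℝ} {q p : Space d} {A B : Matrix (Fin d) (Fin d) ℝ} {φ δ : ℝ}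

theorem norm_gaussian_sq (hB : B.PosDef) (hħ : 0 < ħ) (q p : Space d)
    (A : Matrix (Fin d) (Fin d) ℝ) (φ δ : ℝ) (x : Space d) :
    ‖gaussian ħ q p A B φ δ x‖ ^ 2 = Real.exp (-(2 * δ) / ħ) * weight (coord ħ q B x) := by
  -- The exponent is split into real and imaginary parts: A, p and φ only contribute a phase, and
  -- the modulus sees B and δ alone.
  have h1 : (Complex.I / (ħ : ℂ)) *
    ((1 / 2 : ℂ) * (∑ k, ∑ l,
        ((x k - q k : ℝ) : ℂ) * ((A k l : ℂ) + Complex.I * (B k l : ℂ)) * ((x l - q l : ℝ) : ℂ))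
      + ((∑ k, p k * (x k - q k) : ℝ) : ℂ)
      + ((φ : ℂ) + Complex.I * (δ : ℂ))) =
    ((-(1 / ħ) * (1 / 2 * (∑ k, ∑ l, (x k - q k) * B k l * (x l - q l)) + δ) : ℝ) : ℂ) +
    ((1 / ħ * (1 / 2 * (∑ k, ∑ l, (x k - q k) * A k l * (x l - q l)) +
      ∑ k, p k * (x k - q k) + φ) : ℝ) : ℂ) * Complex.I := by
    have h2 : ∑ k, ∑ l, ((x k - q k : ℝ) : ℂ) * ((A k l : ℂ) + Complex.I * (B k l : ℂ)) *
        ((x l - q l : ℝ) : ℂ) = ((∑ k, ∑ l, (x k - q k) * A k l * (x l - q l) : ℝ) : ℂ) +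
        Complex.I * ((∑ k, ∑ l, (x k - q k) * B k l * (x l - q l) : ℝ) : ℂ) := by
      push_cast
      simp only [Finset.mul_sum, ← Finset.sum_add_distrib]
      exact Finset.sum_congr rfl fun k _ => Finset.sum_congr rfl fun l _ => by ring
    rw [h2]
    set a : ℝ := ∑ k, ∑ l, (x k - q k) * A k l * (x l - q l)
    set b : ℝ := ∑ k, ∑ l, (x k - q k) * B k l * (x l - q l)
    set c : ℝ := ∑ k, p k * (x k - q k)
    push_cast
    linear_combination (1 / (ħ : ℂ)) * (1 / 2 * (b : ℂ) + δ) * Complex.I_sq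
  rw [gaussian, h1, Complex.norm_exp, Complex.add_re, Complex.ofReal_re, Complex.re_ofReal_mul,
    Complex.I_re, mul_zero, add_zero, weight, sum_coord_sq hB hħ, ← Real.exp_add, sq,
    ← Real.exp_add]
  congr 1
  field_simp
  ring

/-- Integrals against `|χ₀|²` are Gaussian means in the normalized coordinates. -/
theorem integral_mul_norm_gaussian_sq (hB : B.PosDef) (hħ : 0 < ħ) (q p : Space d)
    (A : Matrix (Fin d) (Fin d) ℝ) (φ δ : ℝ) (F : (Fin d → ℝ) → ℝ) :
    ∫ x, F (coord ħ q B x) * ‖gaussian ħ q p A B φ δ x‖ ^ 2 = normSq ħ B δ * gaussMean F := by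
  simp only [norm_gaussian_sq hB hħ, mul_left_comm _ (Real.exp _), integral_const_mul]
  rw [integral_comp_coord hB hħ q (fun t => F t * weight t), normSq, gaussMean, smul_eq_mul]
  -- The Jacobian matches the normalization because (πħ)^{1/2} (2/ħ)^{1/2} = (2π)^{1/2}, once per
  -- dimension.
  have h : Real.sqrt ((Real.pi * ħ) ^ d / B.det) * (Real.sqrt (2 * Real.pi))⁻¹ ^ d =
      (Real.sqrt (2 / ħ) ^ d * Real.sqrt B.det)⁻¹ := by
    have hd := hB.det_pos
    have h1 : Real.sqrt (Real.pi * ħ) * Real.sqrt (2 / ħ) = Real.sqrt (2 * Real.pi) := by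
      rw [← Real.sqrt_mul (by positivity)]
      congr 1
      field_simp
    have h2 : Real.sqrt ((Real.pi * ħ) ^ d) = Real.sqrt (Real.pi * ħ) ^ d := by
      rw [Real.sqrt_eq_rpow, Real.sqrt_eq_rpow, ← Real.rpow_natCast_mul (by positivity),
        ← Real.rpow_mul_natCast (by positivity), mul_comm (d : ℝ)]
    rw [Real.sqrt_div (by positivity), h2, inv_pow, ← h1, mul_pow]
    have ha : Real.sqrt (Real.pi * ħ) ≠ 0 := by positivity
    have hb : Real.sqrt (2 / ħ) ≠ 0 := by positivity
    have hc : Real.sqrt B.det ≠ 0 := by positivity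
    field_simp
  rw [← h]
  ring

theorem integrable_mul_norm_gaussian_sq (hB : B.PosDef) (hħ : 0 < ħ) (q p : Space d)
    (A : Matrix (Fin d) (Fin d) ℝ) (φ δ : ℝ) {F : (Fin d → ℝ) → ℝ}
    (hF : Integrable fun t => F t * weight t) :
    Integrable fun x => F (coord ħ q B x) * ‖gaussian ħ q p A B φ δ x‖ ^ 2 := by
  simp only [norm_gaussian_sq hB hħ, mul_left_comm _ (Real.exp _)]
  exact (Integrable.comp_coord hB hħ q hF).const_mul _

end Gaussian

/-! ### Wave packets as Hermite functions -/

section ProdEval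

open Polynomial

variable {d : ℕ} (g : Fin d → ℝ[X]) (j : Fin d) (t : Fin d → ℝ)

theorem prodEval_update (P : ℝ[X]) :
    prodEval (Function.update g j P) t =
      P.eval (t j) * ∏ i ∈ Finset.univ.erase j, (g i).eval (t i) := by
  rw [prodEval, ← Finset.mul_prod_erase _ _ (Finset.mem_univ j), Function.update_self]
  congr 1
  refine Finset.prod_congr rfl fun i hi => ?_
  rw [Function.update_of_ne (Finset.mem_erase.mp hi).1]

theorem prodEval_eq_mul_erase :
    prodEval g t = (g j).eval (t j) * ∏ i ∈ Finset.univ.erase j, (g i).eval (t i) := by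
  rw [← prodEval_update, Function.update_eq_self]

theorem prodEval_update_X_mul :
    prodEval (Function.update g j (X * g j)) t = t j * prodEval g t := by
  rw [prodEval_update, prodEval_eq_mul_erase g j, eval_mul, eval_X, mul_assoc]

theorem prodEval_update_sub (P Q : ℝ[X]) :
    prodEval (Function.update g j (P - Q)) t =
      prodEval (Function.update g j P) t - prodEval (Function.update g j Q) t := by
  simp only [prodEval_update, eval_sub, sub_mul]

theorem prodEval_update_C_mul (c : ℝ) (P : ℝ[X]) :
    prodEval (Function.update g j (C c * P)) t = c * prodEval (Function.update g j P) t := by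
  simp only [prodEval_update, eval_mul, eval_C, mul_assoc]

end ProdEval

/-! ### Momentum and raising operators acting on a real function times the Gaussian -/

section Derivatives

variable {d : ℕ} {ħ : ℝ} {q p : Space d} {A B : Matrix (Fin d) (Fin d) ℝ} {φ δ : ℝ}

/-- The derivative of the `j`-th normalized coordinate. -/
def coordDeriv (ħ : ℝ) (B : Matrix (Fin d) (Fin d) ℝ) (j : Fin d) : Space d →L[ℝ] ℝ :=
  Real.sqrt (2 / ħ) • ∑ k, CFC.sqrt B j k • EuclideanSpace.proj k

theorem coordDeriv_apply (ħ : ℝ) (B : Matrix (Fin d) (Fin d) ℝ) (j : Fin d) (v : Space d) :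
    coordDeriv ħ B j v = Real.sqrt (2 / ħ) * ∑ k, CFC.sqrt B j k * v k := by
  simp only [coordDeriv, smul_apply, sum_apply,
    smul_eq_mul]
  rfl

theorem coordDeriv_e (ħ : ℝ) (B : Matrix (Fin d) (Fin d) ℝ) (j k : Fin d) :
    coordDeriv ħ B j (e k) = Real.sqrt (2 / ħ) * CFC.sqrt B j k := by
  rw [coordDeriv_apply]
  simp [e]

/-- The rows of B^{-1/2} are dual to those of B^{1/2}, so differentiating along `raisingDir B j` is
(2/ħ)^{1/2} ∂/∂t_j. This decouples the raising operators. -/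
theorem coordDeriv_raisingDir (hB : B.PosDef) (ħ : ℝ) (i j : Fin d) :
    coordDeriv ħ B i (raisingDir B j) = if i = j then Real.sqrt (2 / ħ) else 0 := by
  rw [coordDeriv_apply]
  have h : ∑ k, CFC.sqrt B i k * raisingDir B j k = (1 : Matrix (Fin d) (Fin d) ℝ) i j := by
    rw [← sqrt_mul_invSqrt hB, Matrix.mul_apply]
    refine Finset.sum_congr rfl fun k _ => ?_
    rw [raisingDir_apply, (invSqrt_isSymm B).apply]
  rw [h, Matrix.one_apply]
  split_ifs <;> simp

theorem hasFDerivAt_coord (ħ : ℝ) (q : Space d) (B : Matrix (Fin d) (Fin d) ℝ) (j : Fin d)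
    (x : Space d) : HasFDerivAt (fun x => coord ħ q B x j) (coordDeriv ħ B j) x :=
  (HasFDerivAt.fun_sum fun k (_ : k ∈ Finset.univ) =>
    ((EuclideanSpace.proj k : Space d →L[ℝ] ℝ).hasFDerivAt.sub_const (q k)).const_mul
      (CFC.sqrt B j k)).const_mul (Real.sqrt (2 / ħ))

open Polynomial in
theorem hasFDerivAt_prodEval_coord (ħ : ℝ) (q : Space d) (B : Matrix (Fin d) (Fin d) ℝ)
    (g : Fin d → ℝ[X]) (x : Space d) :
    HasFDerivAt (fun x => prodEval g (coord ħ q B x))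
      (∑ j, prodEval (Function.update g j (derivative (g j))) (coord ħ q B x) •
        coordDeriv ħ B j) x := by
  have h (j : Fin d) : HasFDerivAt (fun x => (g j).eval (coord ħ q B x j))
      ((derivative (g j)).eval (coord ħ q B x j) • coordDeriv ħ B j) x :=
    ((g j).hasDerivAt _).comp_hasFDerivAt x (hasFDerivAt_coord ħ q B j x)
  refine (HasFDerivAt.finsetProd fun j (_ : j ∈ Finset.univ) => h j).congr_fderiv ?_
  refine Finset.sum_congr rfl fun j _ => ?_
  rw [smul_smul, prodEval_update, mul_comm]

theorem fderiv_gaussian (hA : A.IsSymm) (hB : B.IsSymm) (ħ : ℝ) (q p : Space d) (φ δ : ℝ)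
    (x v : Space d) :
    fderiv ℝ (gaussian ħ q p A B φ δ) x v = gaussian ħ q p A B φ δ x * (Complex.I / ħ *
      ∑ k, (v k : ℂ) * (∑ l, ((A k l : ℂ) + Complex.I * (B k l : ℂ)) * ((x l - q l : ℝ) : ℂ) +
        (p k : ℂ))) := by
  have h (l : Fin d) : HasFDerivAt (fun x : Space d => ((x l - q l : ℝ) : ℂ))
      (Complex.ofRealCLM ∘L (EuclideanSpace.proj l : Space d →L[ℝ] ℝ)) x :=
    Complex.ofRealCLM.hasFDerivAt.comp x
      ((EuclideanSpace.proj l : Space d →L[ℝ] ℝ).hasFDerivAt.sub_const (q l))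
  have h2 := HasFDerivAt.fun_sum fun k (_ : k ∈ Finset.univ) => HasFDerivAt.fun_sum
    fun l (_ : l ∈ Finset.univ) => ((h k).mul_const
      ((A k l : ℂ) + Complex.I * (B k l : ℂ))).mul (h l)
  have h3 := HasFDerivAt.fun_sum fun k (_ : k ∈ Finset.univ) => (h k).const_mul (p k : ℂ)
  have h4 := ((((h2.const_mul (1 / 2 : ℂ)).add h3).add_const
    ((φ : ℂ) + Complex.I * (δ : ℂ))).const_mul (Complex.I / (ħ : ℂ))).cexp
  have h5 : gaussian ħ q p A B φ δ = fun x => Complex.exp ((Complex.I / (ħ : ℂ)) *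
    ((1 / 2 : ℂ) * (∑ k, ∑ l,
        ((x k - q k : ℝ) : ℂ) * ((A k l : ℂ) + Complex.I * (B k l : ℂ)) * ((x l - q l : ℝ) : ℂ))
      + (∑ k, (p k : ℂ) * ((x k - q k : ℝ) : ℂ))
      + ((φ : ℂ) + Complex.I * (δ : ℂ)))) := by
    funext x
    simp only [gaussian, Complex.ofReal_sum, Complex.ofReal_mul]
  rw [h5]
  have h6 := h4.fderiv
  simp only [Pi.add_def, Pi.mul_def] at h6
  rw [h6]
  simp only [smul_apply, add_apply, sum_apply, smul_eq_mul, ContinuousLinearMap.comp_apply,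
    Complex.ofRealCLM_apply, PiLp.proj_apply]
  congr 2
  set M : Fin d → Fin d → ℂ := fun k l => (A k l : ℂ) + Complex.I * (B k l : ℂ) with hM
  have hMs (k l : Fin d) : M k l = M l k := by simp only [hM, hA.apply k l, hB.apply k l]
  -- By symmetry of A + iB the two terms of the product rule coincide, which cancels the factor 1/2
  -- in the exponent.
  have h7 : ∑ k, ∑ l, (((x k - q k : ℝ) : ℂ) * M k l * (v l : ℂ) +
      ((x l - q l : ℝ) : ℂ) * (M k l * (v k : ℂ))) =
      2 * ∑ k, (v k : ℂ) * ∑ l, M k l * ((x l - q l : ℝ) : ℂ) := by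
    simp only [Finset.sum_add_distrib, two_mul, Finset.mul_sum]
    congr 1
    · rw [Finset.sum_comm]
      refine Finset.sum_congr rfl fun k _ => Finset.sum_congr rfl fun l _ => ?_
      rw [hMs]
      ring
    · refine Finset.sum_congr rfl fun k _ => Finset.sum_congr rfl fun l _ => ?_
      ring
  simp only [hM] at h7
  rw [h7]
  simp only [mul_add, Finset.sum_add_distrib]
  rw [← mul_assoc (1 / 2 : ℂ), show (1 / 2 : ℂ) * 2 = 1 by norm_num, one_mul]
  congr 1
  exact Finset.sum_congr rfl fun k _ => mul_comm (p k : ℂ) (v k : ℂ)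

theorem fderiv_ofReal_mul_gaussian (hA : A.IsSymm) (hB : B.IsSymm) {P : Space d → ℝ}
    {P' : Space d →L[ℝ] ℝ} {x : Space d} (hP : HasFDerivAt P P' x) (v : Space d) :
    fderiv ℝ (fun x => (P x : ℂ) * gaussian ħ q p A B φ δ x) x v =
      ((P' v : ℂ) + P x * (Complex.I / ħ *
      ∑ k, (v k : ℂ) * (∑ l, ((A k l : ℂ) + Complex.I * (B k l : ℂ)) * ((x l - q l : ℝ) : ℂ) +
        (p k : ℂ)))) * gaussian ħ q p A B φ δ x := by
  have h1 : HasFDerivAt (fun x => (P x : ℂ)) (Complex.ofRealCLM ∘L P') x :=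
    Complex.ofRealCLM.hasFDerivAt.comp x hP
  have h2 := h1.mul ((contDiff_gaussian ħ q p A B φ δ).differentiable (by simp) x).hasFDerivAt
  have h3 := h2.fderiv
  simp only [Pi.mul_def] at h3
  rw [h3]
  simp only [smul_apply, add_apply, smul_eq_mul, ContinuousLinearMap.comp_apply,
    Complex.ofRealCLM_apply, fderiv_gaussian hA hB]
  ring

/-- With P real, the two bracketed terms are the real and imaginary parts of the prefactor, so the
squared modulus is a sum of two squares without cross term. -/
theorem momentumOp_ofReal_mul_gaussian (hA : A.IsSymm) (hB : B.IsSymm) (hħ : 0 < ħ)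
    {P : Space d → ℝ} {P' : Space d →L[ℝ] ℝ} {x : Space d} (hP : HasFDerivAt P P' x) (k : Fin d) :
    momentumOp ħ k (fun x => (P x : ℂ) * gaussian ħ q p A B φ δ x) x =
      ((((p k + ∑ l, A k l * (x l - q l)) * P x : ℝ) : ℂ) +
        (((∑ l, B k l * (x l - q l)) * P x - ħ * P' (e k) : ℝ) : ℂ) * Complex.I) *
          gaussian ħ q p A B φ δ x := by
  have hħ' : (ħ : ℂ) ≠ 0 := by exact_mod_cast hħ.ne'
  have h1 : ∑ i, ((e k : Space d) i : ℂ) * (∑ l, ((A i l : ℂ) + Complex.I * (B i l : ℂ)) *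
      ((x l - q l : ℝ) : ℂ) + (p i : ℂ)) = ((∑ l, A k l * (x l - q l) : ℝ) : ℂ) +
        Complex.I * ((∑ l, B k l * (x l - q l) : ℝ) : ℂ) + p k := by
    rw [Finset.sum_eq_single k]
    · simp only [e, PiLp.single_apply, if_true, Complex.ofReal_one, one_mul]
      push_cast
      simp only [Finset.mul_sum, ← Finset.sum_add_distrib]
      congr 1
      exact Finset.sum_congr rfl fun l _ => by ring
    · intro i _ hi
      simp [e, hi]
    · simp
  rw [momentumOp, fderiv_ofReal_mul_gaussian hA hB hP, h1]
  set a : ℝ := ∑ l, A k l * (x l - q l)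
  set b : ℝ := ∑ l, B k l * (x l - q l)
  push_cast
  field_simp
  linear_combination (-((p k : ℂ) + a + Complex.I * b) * P x * gaussian ħ q p A B φ δ x) *
    Complex.I_sq

/-- Since (p̂ - p)χ₀ = (A + iB)(x - q)χ₀, the A terms cancel in the raising operator and the B terms
add up to -2iB(x - q), which becomes multiplication by t_j. -/
theorem raisingOp_ofReal_mul_gaussian (hA : A.IsSymm) (hB : B.PosDef) (hħ : 0 < ħ)
    {P : Space d → ℝ} {P' : Space d →L[ℝ] ℝ} {x : Space d} (hP : HasFDerivAt P P' x) (j : Fin d) :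
    raisingOp ħ q p A B j (fun x => (P x : ℂ) * gaussian ħ q p A B φ δ x) x =
      ((coord ħ q B x j * P x - Real.sqrt (ħ / 2) * P' (raisingDir B j) : ℝ) : ℂ) *
          gaussian ħ q p A B φ δ x := by
  have hħ' : (ħ : ℂ) ≠ 0 := by exact_mod_cast hħ.ne'
  have hs : (0 : ℝ) < Real.sqrt (2 * ħ) := by positivity
  have hs' : ((Real.sqrt (2 * ħ) : ℝ) : ℂ) ≠ 0 := by exact_mod_cast hs.ne'
  have hss : Real.sqrt (2 * ħ) * Real.sqrt (2 * ħ) = 2 * ħ := Real.mul_self_sqrt (by positivity)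
  have h1 : Real.sqrt (2 / ħ) = 2 / Real.sqrt (2 * ħ) := by
    rw [Real.sqrt_eq_iff_mul_self_eq (by positivity) (by positivity), div_mul_div_comm, hss]
    field_simp
  have h2 : Real.sqrt (ħ / 2) = ħ / Real.sqrt (2 * ħ) := by
    rw [Real.sqrt_eq_iff_mul_self_eq (by positivity) (by positivity), div_mul_div_comm, hss]
    field_simp
  have h4 : ∑ k, CFC.sqrt B j k * (x k - q k) =
      ∑ k, invSqrt B j k * ∑ l, B k l * (x l - q l) := by
    conv_lhs => rw [← invSqrt_mul hB]
    simp only [Matrix.mul_apply, Finset.sum_mul, Finset.mul_sum]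
    rw [Finset.sum_comm]
    exact Finset.sum_congr rfl fun k _ => Finset.sum_congr rfl fun l _ => by ring
  -- Used with s = -i for the multiplication part of the operator and with s = i for the derivative
  -- of χ₀.
  have h5 (s : ℂ) : ∑ k, ((invSqrt B j k : ℝ) : ℂ) * (∑ l, ((A k l : ℂ) + s * (B k l : ℂ)) *
      ((x l - q l : ℝ) : ℂ) + (p k : ℂ)) =
      ((∑ k, invSqrt B j k * (∑ l, A k l * (x l - q l) + p k) : ℝ) : ℂ) +
        s * ((∑ k, CFC.sqrt B j k * (x k - q k) : ℝ) : ℂ) := by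
    rw [h4]
    push_cast
    rw [Finset.mul_sum, ← Finset.sum_add_distrib]
    refine Finset.sum_congr rfl fun k _ => ?_
    rw [mul_left_comm s, ← mul_add, add_right_comm, Finset.mul_sum, ← Finset.sum_add_distrib]
    congr 2
    exact Finset.sum_congr rfl fun l _ => by ring
  rw [raisingOp_eq]
  simp only [fderiv_ofReal_mul_gaussian hA (isSymm_of_posDef hB) hP, raisingCoeff, raisingDir_apply]
  have h6 := h5 (-Complex.I)
  simp only [neg_mul, ← sub_eq_add_neg] at h6
  rw [h6, h5, coord, h1, h2]
  set a : ℝ := ∑ k, invSqrt B j k * (∑ l, A k l * (x l - q l) + p k)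
  set b : ℝ := ∑ k, CFC.sqrt B j k * (x k - q k)
  push_cast
  field_simp
  linear_combination gaussian ħ q p A B φ δ x * ((P' (raisingDir B j) : ℂ) * ħ +
    P x * Complex.I * a + P x * b * (Complex.I ^ 2 - 2)) * Complex.I_sq

end Derivatives

/-! ### Identification of the wave packets with products of Hermite polynomials -/

section Packets

open Polynomial

variable {d : ℕ} {ħ : ℝ} {q p : Space d} {A B : Matrix (Fin d) (Fin d) ℝ} {φ δ : ℝ}

theorem raisingOp_prodEval (hA : A.IsSymm) (hB : B.PosDef) (hħ : 0 < ħ) (g : Fin d → ℝ[X])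
    (j : Fin d) :
    raisingOp ħ q p A B j
        (fun x => (prodEval g (coord ħ q B x) : ℂ) * gaussian ħ q p A B φ δ x) =
      fun x => (prodEval (Function.update g j (X * g j - derivative (g j)))
        (coord ħ q B x) : ℂ) * gaussian ħ q p A B φ δ x := by
  funext x
  rw [raisingOp_ofReal_mul_gaussian hA hB hħ (hasFDerivAt_prodEval_coord ħ q B g x),
    prodEval_update_sub, prodEval_update_X_mul]
  simp only [sum_apply, smul_apply, coordDeriv_raisingDir hB, smul_eq_mul, mul_ite, mul_zero,
    Finset.sum_ite_eq', Finset.mem_univ, if_true]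
  rw [mul_left_comm, sqrt_half_mul_sqrt hħ, mul_one]

theorem raisingOp_iterate_prodEval (hA : A.IsSymm) (hB : B.PosDef) (hħ : 0 < ħ)
    (g : Fin d → ℝ[X]) (j : Fin d) (hg : g j = 1) (m : ℕ) :
    (raisingOp ħ q p A B j)^[m]
        (fun x => (prodEval g (coord ħ q B x) : ℂ) * gaussian ħ q p A B φ δ x) =
      fun x => (prodEval (Function.update g j (hermiteR m)) (coord ħ q B x) : ℂ) *
        gaussian ħ q p A B φ δ x := by
  induction m with
  | zero => simp [hermiteR_zero, ← hg]
  | succ m ih =>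
    rw [Function.iterate_succ_apply', ih, raisingOp_prodEval hA hB hħ]
    simp [hermiteR_succ]

/-- Coordinates not yet treated carry the factor 1 = He_0; since `L` has no repetition, each block
of raising operators starts from that factor. -/
theorem foldr_raisingOp_gaussian (hA : A.IsSymm) (hB : B.PosDef) (hħ : 0 < ħ) (n : Fin d → ℕ)
    (L : List (Fin d)) (hL : L.Nodup) :
    L.foldr (fun j f => (raisingOp ħ q p A B j)^[n j] f) (gaussian ħ q p A B φ δ) =
      fun x => (prodEval (fun i => if i ∈ L then hermiteR (n i) else 1) (coord ħ q B x) : ℂ) *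
        gaussian ħ q p A B φ δ x := by
  induction L with
  | nil => simp [prodEval]
  | cons k L ih =>
    obtain ⟨hk, hL'⟩ := List.nodup_cons.mp hL
    rw [List.foldr_cons, ih hL', raisingOp_iterate_prodEval hA hB hħ _ k (by simp [hk])]
    congr! 4 with x
    funext i
    by_cases hi : i = k
    · subst hi
      simp
    · simp [hi]

/-- The polynomial prefactor `∏ He_{nᵢ}(tᵢ)`. -/
def hermiteProd (n : Fin d → ℕ) : (Fin d → ℝ) → ℝ := prodEval fun i => hermiteR (n i)

/-- The normalization `∏ (nᵢ!)^{-1/2}`. -/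
def packetNorm (n : Fin d → ℕ) : ℝ := ∏ j, (1 / Real.sqrt ((n j).factorial : ℝ))

theorem wavePacket_eq (hA : A.IsSymm) (hB : B.PosDef) (hħ : 0 < ħ) (n : Fin d → ℕ) :
    wavePacket ħ q p A B φ δ n = fun x =>
      ((packetNorm n * hermiteProd n (coord ħ q B x) : ℝ) : ℂ) * gaussian ħ q p A B φ δ x := by
  rw [wavePacket, foldr_raisingOp_gaussian hA hB hħ n _ (List.nodup_finRange d)]
  funext x
  simp [hermiteProd, packetNorm, mul_assoc]

theorem packetNorm_sq (n : Fin d → ℕ) :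
    packetNorm n ^ 2 * ∏ j, polyMean (hermiteR (n j) * hermiteR (n j)) = 1 := by
  rw [packetNorm, ← Finset.prod_pow, ← Finset.prod_mul_distrib]
  refine Finset.prod_eq_one fun j _ => ?_
  have h : (0 : ℝ) < (n j).factorial := by exact_mod_cast Nat.factorial_pos _
  rw [polyMean_hermiteR_sq, div_pow, Real.sq_sqrt h.le]
  field_simp

end Packets

/-! ### Functions of temperate growth times the Gaussian -/

/-- The functions `P χ₀` with `P` smooth of temperate growth. -/
def IsPacket {d : ℕ} (ħ : ℝ) (q p : Space d) (A B : Matrix (Fin d) (Fin d) ℝ) (φ δ : ℝ)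
    (f : Space d → ℂ) : Prop :=
  ∃ P : Space d → ℂ, P.HasTemperateGrowth ∧ f = fun x => P x * gaussian ħ q p A B φ δ x

theorem _root_.Function.HasTemperateGrowth.fderiv_apply {E F : Type*} [NormedAddCommGroup E]
    [NormedSpace ℝ E] [NormedAddCommGroup F] [NormedSpace ℝ F] {f : E → F}
    (hf : f.HasTemperateGrowth) (v : E) :
    Function.HasTemperateGrowth fun x => fderiv ℝ f x v := by
  have h : Function.HasTemperateGrowth (fderiv ℝ f) := by
    refine ⟨hf.1.fderiv_right (m := (⊤ : ℕ∞)) (by simp), fun n => ?_⟩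
    obtain ⟨k, C, h⟩ := hf.2 (n + 1)
    exact ⟨k, C, fun x => by rw [norm_iteratedFDeriv_fderiv]; exact h x⟩
  exact (ContinuousLinearMap.apply ℝ F v).hasTemperateGrowth.comp h

section Growth

variable {d : ℕ} {ħ : ℝ} {q p : Space d} {A B : Matrix (Fin d) (Fin d) ℝ} {φ δ : ℝ}

/-- From a + s ≤ exp(a + s), and ks ≤ εs² + k²/(4ε) by completing the square. -/
theorem add_pow_le_mul_exp_sq {a : ℝ} (ha : 0 ≤ a) (k : ℕ) {ε : ℝ} (hε : 0 < ε) {s : ℝ}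
    (hs : 0 ≤ s) : (a + s) ^ k ≤ Real.exp (k * a + k ^ 2 / (4 * ε)) * Real.exp (ε * s ^ 2) := by
  have h1 : a + s ≤ Real.exp (a + s) := by linarith [Real.add_one_le_exp (a + s)]
  refine (pow_le_pow_left₀ (by positivity) h1 k).trans ?_
  rw [← Real.exp_nat_mul, ← Real.exp_add]
  refine Real.exp_le_exp.mpr ?_
  have h2 : 0 ≤ (2 * ε * s - k) ^ 2 / (4 * ε) := by positivity
  have h3 : (2 * ε * s - k) ^ 2 / (4 * ε) = ε * s ^ 2 - k * s + k ^ 2 / (4 * ε) := by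
    field_simp
    ring
  nlinarith

theorem exp_norm_sub_sq_le (hB : B.PosDef) (hħ : 0 < ħ) (q : Space d) {ε : ℝ} (hε : 0 < ε) :
    ∃ η > 0, ∀ x, Real.exp (η * ‖x - q‖ ^ 2) ≤ Real.exp (ε * ∑ j, coord ħ q B x j ^ 2) := by
  have hκ := spread_nonneg B
  -- The added 1 keeps the denominator positive even when `spread B` is zero, as in dimension 0.
  refine ⟨ε / (ħ / 2 * spread B + 1), by positivity, fun x => Real.exp_le_exp.mpr ?_⟩
  have h := norm_sub_sq_le hB hħ q x
  have h0 : 0 ≤ ∑ j, coord ħ q B x j ^ 2 := Finset.sum_nonneg fun _ _ => sq_nonneg _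
  rw [div_mul_eq_mul_div, div_le_iff₀ (by positivity), mul_assoc]
  refine mul_le_mul_of_nonneg_left ?_ hε.le
  nlinarith

/-- A function of temperate growth is bounded by `exp(ε|t|²)`. -/
theorem norm_le_exp_coord (hB : B.PosDef) (hħ : 0 < ħ) (q : Space d) {F : Type*}
    [NormedAddCommGroup F] [NormedSpace ℝ F] {P : Space d → F}
    (hP : P.HasTemperateGrowth) {ε : ℝ} (hε : 0 < ε) :
    ∃ C, 0 ≤ C ∧ ∀ x, ‖P x‖ ≤ C * Real.exp (ε * ∑ j, coord ħ q B x j ^ 2) := by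
  obtain ⟨k, C, h⟩ := hP.2 0
  obtain ⟨η, hη, h2⟩ := exp_norm_sub_sq_le hB hħ q hε
  refine ⟨|C| * Real.exp (k * (1 + ‖q‖) + k ^ 2 / (4 * η)), by positivity, fun x => ?_⟩
  have h1 : 1 + ‖x‖ ≤ (1 + ‖q‖) + ‖x - q‖ := by
    have := norm_add_le q (x - q)
    rw [add_sub_cancel] at this
    linarith
  have h3 := h x
  rw [norm_iteratedFDeriv_zero] at h3
  calc ‖P x‖ ≤ C * (1 + ‖x‖) ^ k := h3
    _ ≤ |C| * ((1 + ‖q‖) + ‖x - q‖) ^ k := by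
      gcongr
      exact le_abs_self C
    _ ≤ |C| * (Real.exp (k * (1 + ‖q‖) + k ^ 2 / (4 * η)) * Real.exp (η * ‖x - q‖ ^ 2)) := by
      gcongr
      exact add_pow_le_mul_exp_sq (by positivity) k hη (norm_nonneg _)
    _ ≤ _ := by
      rw [← mul_assoc]
      exact mul_le_mul_of_nonneg_left (h2 x) (by positivity)

/-- Squaring doubles the exponent, so a < 1/4 is what the weight exp(-|t|²/2) can absorb. -/
theorem memLp_mul_gaussian (hB : B.PosDef) (hħ : 0 < ħ) {P : Space d → ℂ} (hP : Continuous P)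
    {C a : ℝ} (ha : a < 1 / 4)
    (hb : ∀ x, ‖P x‖ ≤ C * Real.exp (a * ∑ j, coord ħ q B x j ^ 2)) :
    MemLp (fun x => P x * gaussian ħ q p A B φ δ x) 2 volume := by
  have hg : Continuous (gaussian ħ q p A B φ δ) := (contDiff_gaussian ħ q p A B φ δ).continuous
  have hc : Continuous fun x => P x * gaussian ħ q p A B φ δ x := hP.mul hg
  rw [memLp_two_iff_integrable_sq_norm hc.aestronglyMeasurable]
  have hi : Integrable fun t : Fin d → ℝ =>
      (C ^ 2 * Real.exp (2 * a * ∑ j, t j ^ 2)) * weight t :=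
    integrable_mul_weight (by fun_prop) (c := C ^ 2) (a := 2 * a) (by linarith)
      fun t => (abs_of_nonneg (by positivity)).le
  refine (integrable_mul_norm_gaussian_sq hB hħ q p A φ δ hi).mono'
    (hc.norm.pow 2).aestronglyMeasurable (Filter.Eventually.of_forall fun x => ?_)
  rw [Real.norm_eq_abs, abs_of_nonneg (by positivity), norm_mul, mul_pow]
  refine mul_le_mul_of_nonneg_right ?_ (by positivity)
  refine (pow_le_pow_left₀ (norm_nonneg _) (hb x) 2).trans (le_of_eq ?_)
  rw [mul_pow, ← Real.exp_nat_mul]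
  push_cast
  ring_nf

end Growth

/-! ### Integration by parts for the kinetic operator -/

section IsPacket

variable {d : ℕ} {ħ : ℝ} {q p : Space d} {A B : Matrix (Fin d) (Fin d) ℝ} {φ δ : ℝ}
  {f g : Space d → ℂ}

theorem IsPacket.contDiff (hf : IsPacket ħ q p A B φ δ f) : ContDiff ℝ (⊤ : ℕ∞) f := by
  obtain ⟨P, hP, rfl⟩ := hf
  exact hP.1.mul (contDiff_gaussian ħ q p A B φ δ)

theorem IsPacket.memLp (hB : B.PosDef) (hħ : 0 < ħ) (hf : IsPacket ħ q p A B φ δ f) :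
    MemLp f 2 volume := by
  obtain ⟨P, hP, rfl⟩ := hf
  obtain ⟨C, -, h⟩ := norm_le_exp_coord hB hħ q hP (ε := 1 / 8) (by norm_num)
  exact memLp_mul_gaussian hB hħ hP.1.continuous (by norm_num) h

/-- Differentiating χ₀ only produces an affine factor. This closure puts repeated momenta of a
packet in L² and supplies the integrability needed for integration by parts. -/
theorem IsPacket.momentumOp (hA : A.IsSymm) (hB : B.IsSymm) (hf : IsPacket ħ q p A B φ δ f)
    (k : Fin d) : IsPacket ħ q p A B φ δ (momentumOp ħ k f) := by
  obtain ⟨P, hP, rfl⟩ := hf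
  have hl (l : Fin d) : Function.HasTemperateGrowth fun x : Space d => ((x l - q l : ℝ) : ℂ) := by
    have h1 : Function.HasTemperateGrowth fun x : Space d => (x l : ℝ) :=
      (EuclideanSpace.proj l : Space d →L[ℝ] ℝ).hasTemperateGrowth
    exact Function.Complex.hasTemperateGrowth_ofReal.comp (h1.sub (.const (q l)))
  have hP' := hP.fderiv_apply (e k)
  refine ⟨fun x => -Complex.I * ħ * (fderiv ℝ P x (e k) + P x * (Complex.I / ħ *
    ∑ i, ((e k : Space d) i : ℂ) * (∑ l, ((A i l : ℂ) + Complex.I * (B i l : ℂ)) *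
      ((x l - q l : ℝ) : ℂ) + (p i : ℂ)))), by fun_prop, ?_⟩
  funext x
  have h1 := ((hP.1.differentiable (by simp) x).hasFDerivAt.mul
    ((contDiff_gaussian ħ q p A B φ δ).differentiable (by simp) x).hasFDerivAt).fderiv
  simp only [Pi.mul_def] at h1
  rw [Semiclassical.momentumOp, h1]
  simp only [smul_apply, add_apply, smul_eq_mul, fderiv_gaussian hA hB]
  ring

theorem integrable_conj_mul (hf : MemLp f 2 volume) (hg : MemLp g 2 volume) :
    Integrable fun x => (starRingEnd ℂ) (f x) * g x :=
  hf.star.integrable_mul hg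

/-- The momentum operators are symmetric. -/
theorem integral_conj_mul_momentumOp (hA : A.IsSymm) (hB : B.PosDef) (hħ : 0 < ħ)
    (hf : IsPacket ħ q p A B φ δ f) (hg : IsPacket ħ q p A B φ δ g) (k : Fin d) :
    ∫ x, (starRingEnd ℂ) (f x) * momentumOp ħ k g x =
      ∫ x, (starRingEnd ℂ) (momentumOp ħ k f x) * g x := by
  have hħ' : (ħ : ℂ) ≠ 0 := by exact_mod_cast hħ.ne'
  have hfd : Differentiable ℝ f := hf.contDiff.differentiable (by simp)
  have hgd : Differentiable ℝ g := hg.contDiff.differentiable (by simp)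
  have hc (x : Space d) : HasFDerivAt (fun x => (starRingEnd ℂ) (f x))
      ((Complex.conjCLE : ℂ →L[ℝ] ℂ) ∘L fderiv ℝ f x) x :=
    (Complex.conjCLE : ℂ →L[ℝ] ℂ).hasFDerivAt.comp x (hfd x).hasFDerivAt
  have hcv (x : Space d) : fderiv ℝ (fun x => (starRingEnd ℂ) (f x)) x (e k) =
      (starRingEnd ℂ) (fderiv ℝ f x (e k)) := by
    rw [(hc x).fderiv]
    rfl
  have hI : -Complex.I * (ħ : ℂ) ≠ 0 := mul_ne_zero (neg_ne_zero.mpr Complex.I_ne_zero) hħ'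
  have hBs := isSymm_of_posDef hB
  have h1 := integrable_conj_mul (hf.memLp hB hħ) ((hg.momentumOp hA hBs k).memLp hB hħ)
  have h2 := integrable_conj_mul ((hf.momentumOp hA hBs k).memLp hB hħ) (hg.memLp hB hħ)
  have h3 := integrable_conj_mul (hf.memLp hB hħ) (hg.memLp hB hħ)
  have e1 : (fun x => (starRingEnd ℂ) (f x) * momentumOp ħ k g x) = fun x =>
      (-Complex.I * (ħ : ℂ)) * ((starRingEnd ℂ) (f x) * fderiv ℝ g x (e k)) := by
    funext x
    rw [momentumOp]
    ring
  have e2 : (fun x => (starRingEnd ℂ) (momentumOp ħ k f x) * g x) = fun x =>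
      -(-Complex.I * (ħ : ℂ)) * (fderiv ℝ (fun x => (starRingEnd ℂ) (f x)) x (e k) * g x) := by
    funext x
    rw [hcv, momentumOp]
    simp only [map_mul, map_neg, Complex.conj_I, Complex.conj_ofReal]
    ring
  rw [e1] at h1 ⊢
  rw [e2] at h2 ⊢
  -- Integrability of the bare products, as integration by parts requires, is obtained by dividing
  -- out the nonzero scalar ∓iħ.
  have h1' := (integrable_const_mul_iff (isUnit_iff_ne_zero.mpr hI) _).mp h1
  have h2' := (integrable_const_mul_iff (isUnit_iff_ne_zero.mpr (neg_ne_zero.mpr hI)) _).mp h2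
  rw [integral_const_mul, integral_const_mul,
    integral_mul_fderiv_eq_neg_fderiv_mul_of_integrable h2' h1' h3
      (fun x _ => (hc x).differentiableAt) (fun x _ => hgd x)]
  ring

theorem kineticOp_eq_sum (ħ m : ℝ) {f : Space d → ℂ} (hf : ContDiff ℝ (⊤ : ℕ∞) f) :
    kineticOp ħ m f = fun x =>
      ∑ k, ((1 / (2 * m) : ℝ) : ℂ) * momentumOp ħ k (momentumOp ħ k f) x := by
  funext x
  have hf' : Differentiable ℝ (fderiv ℝ f) :=
    (hf.fderiv_right (m := (⊤ : ℕ∞)) (by simp)).differentiable (by simp)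
  have h (k : Fin d) : momentumOp ħ k (momentumOp ħ k f) x =
      -(ħ : ℂ) ^ 2 * fderiv ℝ (fderiv ℝ f) x (e k) (e k) := by
    have h1 := ((((hf' x).hasFDerivAt.clm_apply (hasFDerivAt_const (e k) x)).const_mul
      (-Complex.I * (ħ : ℂ)))).fderiv
    have h2 : momentumOp ħ k f = fun x => -Complex.I * (ħ : ℂ) * fderiv ℝ f x (e k) := rfl
    rw [momentumOp, h2, h1]
    simp only [smul_apply, add_apply, smul_eq_mul, ContinuousLinearMap.comp_apply, zero_apply,
      map_zero, zero_add, ContinuousLinearMap.flip_apply]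
    linear_combination (ħ : ℂ) ^ 2 * fderiv ℝ (fderiv ℝ f) x (e k) (e k) * Complex.I_sq
  rw [kineticOp, InnerProductSpace.laplacian_eq_iteratedFDeriv_orthonormalBasis f
    (EuclideanSpace.basisFun (Fin d) ℝ)]
  simp only [h, iteratedFDeriv_two_apply, EuclideanSpace.basisFun_apply, Finset.mul_sum]
  refine Finset.sum_congr rfl fun k _ => ?_
  simp only [e, Matrix.cons_val_zero, Matrix.cons_val_one]
  push_cast
  ring

theorem IsPacket.memLp_kineticOp (hA : A.IsSymm) (hB : B.PosDef) (hħ : 0 < ħ)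
    (m : ℝ) (hf : IsPacket ħ q p A B φ δ f) : MemLp (kineticOp ħ m f) 2 volume := by
  rw [kineticOp_eq_sum ħ m hf.contDiff]
  have hBs := isSymm_of_posDef hB
  exact memLp_finsetSum _ fun k _ =>
    (((hf.momentumOp hA hBs k).momentumOp hA hBs k).memLp hB hħ).const_mul _

/-- Moving one of the two momentum operators to the left factor leaves only first derivatives of f
to be computed. -/
theorem innerL2_kineticOp (hA : A.IsSymm) (hB : B.PosDef) (hħ : 0 < ħ)
    (m : ℝ) (hf : IsPacket ħ q p A B φ δ f) :
    innerL2 f (kineticOp ħ m f) =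
      ((1 / (2 * m) * ∑ k, ∫ x, ‖momentumOp ħ k f x‖ ^ 2 : ℝ) : ℂ) := by
  have h1 (k : Fin d) := hf.momentumOp hA (isSymm_of_posDef hB) k
  rw [kineticOp_eq_sum ħ m hf.contDiff, innerL2]
  simp only [Finset.mul_sum, mul_left_comm _ ((1 / (2 * m) : ℝ) : ℂ)]
  rw [integral_finsetSum _ fun k _ => (integrable_conj_mul (hf.memLp hB hħ)
    (((h1 k).momentumOp hA (isSymm_of_posDef hB) k).memLp hB hħ)).const_mul _]
  rw [Complex.ofReal_sum]
  refine Finset.sum_congr rfl fun k _ => ?_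
  rw [integral_const_mul, integral_conj_mul_momentumOp hA hB hħ hf (h1 k), Complex.ofReal_mul,
    ← integral_complex_ofReal]
  congr 2
  funext x
  rw [Complex.conj_mul', Complex.ofReal_pow]

end IsPacket

/-! ### The kinetic energy of a wave packet -/

section Kinetic

open Polynomial

variable {d : ℕ} {ħ : ℝ} {q p : Space d} {A B : Matrix (Fin d) (Fin d) ℝ} {φ δ : ℝ}

theorem hasTemperateGrowth_eval (P : ℝ[X]) : Function.HasTemperateGrowth fun s : ℝ => P.eval s := by
  induction P using Polynomial.induction_on' with
  | add P Q hP hQ =>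
    simp only [eval_add]
    exact hP.add hQ
  | monomial k a =>
    simp only [eval_monomial]
    exact (Function.HasTemperateGrowth.const a).mul (Function.HasTemperateGrowth.id'.pow k)

theorem hasTemperateGrowth_coord (ħ : ℝ) (q : Space d) (B : Matrix (Fin d) (Fin d) ℝ) (j : Fin d) :
    Function.HasTemperateGrowth fun x => coord ħ q B x j := by
  have h (k : Fin d) : Function.HasTemperateGrowth fun x : Space d => x k - q k :=
    Function.HasTemperateGrowth.sub
      (EuclideanSpace.proj k : Space d →L[ℝ] ℝ).hasTemperateGrowth (.const (q k))
  unfold coord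
  fun_prop

theorem hasTemperateGrowth_prodEval_coord (ħ : ℝ) (q : Space d) (B : Matrix (Fin d) (Fin d) ℝ)
    (g : Fin d → ℝ[X]) : Function.HasTemperateGrowth fun x => prodEval g (coord ħ q B x) := by
  simp only [prodEval]
  induction (Finset.univ : Finset (Fin d)) using Finset.induction_on with
  | empty => simp
  | insert i s hi ih =>
    simp only [Finset.prod_insert hi]
    exact ((hasTemperateGrowth_eval (g i)).comp (hasTemperateGrowth_coord ħ q B i)).mul ih

theorem isPacket_wavePacket (hA : A.IsSymm) (hB : B.PosDef) (hħ : 0 < ħ) (n : Fin d → ℕ) :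
    IsPacket ħ q p A B φ δ (wavePacket ħ q p A B φ δ n) := by
  refine ⟨_, ?_, wavePacket_eq hA hB hħ n⟩
  have h : Function.HasTemperateGrowth fun x => packetNorm n * hermiteProd n (coord ħ q B x) :=
    (Function.HasTemperateGrowth.const _).mul (hasTemperateGrowth_prodEval_coord ħ q B _)
  exact Function.Complex.hasTemperateGrowth_ofReal.comp h

/-- `t_j ∏ He_{nᵢ}(tᵢ)` -/
def positionProd (n : Fin d → ℕ) (j : Fin d) : (Fin d → ℝ) → ℝ :=
  prodEval (Function.update (fun i => hermiteR (n i)) j (X * hermiteR (n j)))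

/-- `(t_j - 2∂_j) ∏ He_{nᵢ}(tᵢ)` -/
def ladderProd (n : Fin d → ℕ) (j : Fin d) : (Fin d → ℝ) → ℝ :=
  prodEval (Function.update (fun i => hermiteR (n i)) j
    (X * hermiteR (n j) - C 2 * derivative (hermiteR (n j))))

theorem positionProd_eq (n : Fin d → ℕ) (j : Fin d) (t : Fin d → ℝ) :
    positionProd n j t = t j * hermiteProd n t :=
  prodEval_update_X_mul (fun i => hermiteR (n i)) j t

theorem sum_mul_sub_eq (hB : B.PosDef) (hħ : 0 < ħ) (q x : Space d)
    (M : Matrix (Fin d) (Fin d) ℝ) (k : Fin d) :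
    ∑ l, M k l * (x l - q l) =
      Real.sqrt (ħ / 2) * ∑ j, (M * invSqrt B) k j * coord ħ q B x j := by
  simp only [sub_eq_sum_coord hB hħ q x, Matrix.mul_apply, Finset.mul_sum, Finset.sum_mul]
  rw [Finset.sum_comm]
  exact Finset.sum_congr rfl fun k _ => Finset.sum_congr rfl fun l _ => by ring

theorem norm_momentumOp_wavePacket_sq (hA : A.IsSymm) (hB : B.PosDef) (hħ : 0 < ħ) (n : Fin d → ℕ)
    (k : Fin d) (x : Space d) :
    ‖momentumOp ħ k (wavePacket ħ q p A B φ δ n) x‖ ^ 2 =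
      (packetNorm n ^ 2 *
        ((p k * hermiteProd n (coord ħ q B x) + Real.sqrt (ħ / 2) *
          ∑ j, (A * invSqrt B) k j * positionProd n j (coord ħ q B x)) ^ 2 +
        (Real.sqrt (ħ / 2) * ∑ j, CFC.sqrt B k j * ladderProd n j (coord ħ q B x)) ^ 2)) *
      ‖gaussian ħ q p A B φ δ x‖ ^ 2 := by
  have hd := (hasFDerivAt_prodEval_coord ħ q B (fun i => hermiteR (n i)) x).const_mul (packetNorm n)
  -- The chain rule gives ħ∂_k the factor ħ(2/ħ)^{1/2}, while B(x - q) carries (ħ/2)^{1/2}; their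
  -- ratio is the 2 in t_j - 2∂_j.
  have hs : ħ * Real.sqrt (2 / ħ) = 2 * Real.sqrt (ħ / 2) := by
    have h1 : ħ = 2 * (Real.sqrt (ħ / 2) * Real.sqrt (ħ / 2)) := by
      rw [Real.mul_self_sqrt (by positivity)]
      ring
    have h2 := sqrt_half_mul_sqrt hħ
    linear_combination Real.sqrt (2 / ħ) * h1 + 2 * Real.sqrt (ħ / 2) * h2
  have h1 := momentumOp_ofReal_mul_gaussian (q := q) (p := p) (φ := φ) (δ := δ) hA
    (isSymm_of_posDef hB) hħ hd k
  have h2 : wavePacket ħ q p A B φ δ n = fun x => ((packetNorm n *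
      prodEval (fun i => hermiteR (n i)) (coord ħ q B x) : ℝ) : ℂ) *
        gaussian ħ q p A B φ δ x := wavePacket_eq hA hB hħ n
  rw [h2, h1, norm_mul, mul_pow, Complex.norm_add_mul_I, Real.sq_sqrt (by positivity)]
  congr 1
  rw [mul_add, ← mul_pow, ← mul_pow]
  congr 2
  · rw [sum_mul_sub_eq hB hħ]
    simp only [positionProd_eq, hermiteProd, ← mul_assoc, ← Finset.sum_mul]
    ring
  · rw [sum_mul_sub_eq hB hħ, mul_invSqrt hB]
    simp only [smul_apply, sum_apply, coordDeriv_e, ladderProd, prodEval_update_sub,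
      prodEval_update_C_mul, prodEval_update_X_mul (fun i => hermiteR (n i)), smul_eq_mul,
      mul_sub, Finset.sum_sub_distrib, Finset.mul_sum, Finset.sum_mul]
    congr 1
    · exact Finset.sum_congr rfl fun j _ => by ring
    · refine Finset.sum_congr rfl fun j _ => ?_
      rw [(sqrt_isSymm B).apply k j]
      linear_combination (packetNorm n * prodEval (Function.update (fun i => hermiteR (n i)) j
        (derivative (hermiteR (n j)))) (coord ħ q B x) * CFC.sqrt B k j) * hs

theorem gaussMean_position_quadratic (n : Fin d → ℕ) (a : Fin d → Fin d → ℝ) :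
    gaussMean (fun t => ∑ i, ∑ j, a i j * (positionProd n i t * positionProd n j t)) =
      (∑ j, a j j * (2 * n j + 1)) * ∏ k, polyMean (hermiteR (n k) * hermiteR (n k)) :=
  gaussMean_quadratic (h := fun i => hermiteR (n i)) (r := fun i => X * hermiteR (n i))
    (fun i => polyMean_X_mul_hermiteR_mul (n i))
    (fun i => by rw [polyMean_X_mul_hermiteR_sq, polyMean_hermiteR_sq]) a

theorem gaussMean_ladder_quadratic (n : Fin d → ℕ) (a : Fin d → Fin d → ℝ) :
    gaussMean (fun t => ∑ i, ∑ j, a i j * (ladderProd n i t * ladderProd n j t)) =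
      (∑ j, a j j * (2 * n j + 1)) * ∏ k, polyMean (hermiteR (n k) * hermiteR (n k)) :=
  gaussMean_quadratic (h := fun i => hermiteR (n i))
    (r := fun i => X * hermiteR (n i) - C 2 * derivative (hermiteR (n i)))
    (fun i => polyMean_ladder_mul_hermiteR (n i))
    (fun i => by rw [polyMean_ladder_sq, polyMean_hermiteR_sq]) a

theorem gaussMean_position_linear (n : Fin d → ℕ) (a : Fin d → ℝ) :
    gaussMean (fun t => ∑ j, a j * (positionProd n j t * hermiteProd n t)) = 0 :=
  gaussMean_linear (h := fun i => hermiteR (n i)) (r := fun i => X * hermiteR (n i))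
    (fun i => polyMean_X_mul_hermiteR_mul (n i)) a

theorem gaussMean_hermiteProd_sq (n : Fin d → ℕ) :
    gaussMean (fun t => hermiteProd n t * hermiteProd n t) =
      ∏ k, polyMean (hermiteR (n k) * hermiteR (n k)) :=
  gaussMean_prodEval_sq

theorem integrable_prodEval_mul_prodEval (g h : Fin d → ℝ[X]) :
    Integrable fun t => prodEval g t * prodEval h t * weight t := by
  simp only [← prodEval_mul]
  exact integrable_prodEval_mul_weight _

theorem integrable_quadratic (g : Fin d → Fin d → ℝ[X]) (a : Fin d → Fin d → ℝ) :
    Integrable fun t =>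
      (∑ i, ∑ j, a i j * (prodEval (g i) t * prodEval (g j) t)) * weight t := by
  simp only [Finset.sum_mul, mul_assoc (a _ _)]
  exact integrable_finsetSum _ fun i _ => integrable_finsetSum _ fun j _ =>
    (integrable_prodEval_mul_prodEval _ _).const_mul _

theorem integrable_linear (g : Fin d → Fin d → ℝ[X]) (h : Fin d → ℝ[X]) (a : Fin d → ℝ) :
    Integrable fun t => (∑ j, a j * (prodEval (g j) t * prodEval h t)) * weight t := by
  simp only [Finset.sum_mul, mul_assoc (a _)]
  exact integrable_finsetSum _ fun j _ => (integrable_prodEval_mul_prodEval _ _).const_mul _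

/-- The mean of a quadratic polynomial in `t` in a normalized Hermite state. -/
theorem packetNorm_sq_mul_gaussMean (n : Fin d → ℕ) (c : ℝ) (b : Fin d → ℝ)
    (a : Fin d → Fin d → ℝ) :
    packetNorm n ^ 2 * gaussMean (fun t => (c * (hermiteProd n t * hermiteProd n t) +
      ∑ j, b j * (positionProd n j t * hermiteProd n t)) +
      ∑ i, ∑ j, a i j * (positionProd n i t * positionProd n j t)) =
      c + ∑ j, a j j * (2 * n j + 1) := by
  have i1 : Integrable fun t => (c * (hermiteProd n t * hermiteProd n t)) * weight t := by
    simp only [mul_assoc c]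
    exact (integrable_prodEval_mul_prodEval _ _).const_mul c
  have i2 : Integrable fun t =>
      (∑ j, b j * (positionProd n j t * hermiteProd n t)) * weight t := integrable_linear _ _ b
  have i3 : Integrable fun t =>
      (∑ i, ∑ j, a i j * (positionProd n i t * positionProd n j t)) * weight t :=
    integrable_quadratic _ a
  rw [gaussMean_add (by simpa only [add_mul] using! i1.add i2) i3, gaussMean_add i1 i2,
    gaussMean_const_mul, gaussMean_position_linear, gaussMean_position_quadratic,
    gaussMean_hermiteProd_sq]
  linear_combination (c + ∑ j, a j j * (2 * n j + 1)) * packetNorm_sq n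

theorem packetNorm_sq_mul_gaussMean_ladder (n : Fin d → ℕ) (a : Fin d → Fin d → ℝ) :
    packetNorm n ^ 2 * gaussMean (fun t =>
      ∑ i, ∑ j, a i j * (ladderProd n i t * ladderProd n j t)) = ∑ j, a j j * (2 * n j + 1) := by
  rw [gaussMean_ladder_quadratic]
  linear_combination (∑ j, a j j * (2 * n j + 1)) * packetNorm_sq n

/-- In the expanded squares the terms linear in p_k t_j have mean zero, and only the diagonal of
each quadratic form survives, with weight 2n_j + 1. -/
theorem integral_norm_momentumOp_sq (hA : A.IsSymm) (hB : B.PosDef) (hħ : 0 < ħ) (n : Fin d → ℕ)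
    (k : Fin d) :
    ∫ x, ‖momentumOp ħ k (wavePacket ħ q p A B φ δ n) x‖ ^ 2 = normSq ħ B δ *
      (p k ^ 2 + ħ / 2 * ∑ j, ((A * invSqrt B) k j ^ 2 + CFC.sqrt B k j ^ 2) * (2 * n j + 1)) := by
  simp only [norm_momentumOp_wavePacket_sq hA hB hħ]
  have hs : Real.sqrt (ħ / 2) ^ 2 = ħ / 2 := Real.sq_sqrt (by positivity)
  rw [integral_mul_norm_gaussian_sq hB hħ q p A φ δ (fun t => packetNorm n ^ 2 *
        ((p k * hermiteProd n t + Real.sqrt (ħ / 2) *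
          ∑ j, (A * invSqrt B) k j * positionProd n j t) ^ 2 +
        (Real.sqrt (ħ / 2) * ∑ j, CFC.sqrt B k j * ladderProd n j t) ^ 2)),
    gaussMean_const_mul]
  congr 1
  have e1 (t : Fin d → ℝ) : (p k * hermiteProd n t + Real.sqrt (ħ / 2) *
          ∑ j, (A * invSqrt B) k j * positionProd n j t) ^ 2 =
      (p k ^ 2 * (hermiteProd n t * hermiteProd n t) +
      ∑ j, (2 * p k * Real.sqrt (ħ / 2) * (A * invSqrt B) k j) *
        (positionProd n j t * hermiteProd n t)) +
      ∑ i, ∑ j, (ħ / 2 * ((A * invSqrt B) k i * (A * invSqrt B) k j)) *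
        (positionProd n i t * positionProd n j t) := by
    rw [add_sq, mul_pow (Real.sqrt _), hs, sq (∑ j, _), Finset.sum_mul_sum, mul_pow]
    simp only [Finset.mul_sum]
    congr 1
    · congr 1
      · ring
      · exact Finset.sum_congr rfl fun j _ => by ring
    · exact Finset.sum_congr rfl fun i _ => Finset.sum_congr rfl fun j _ => by ring
  have e2 (t : Fin d → ℝ) : (Real.sqrt (ħ / 2) * ∑ j, CFC.sqrt B k j * ladderProd n j t) ^ 2 =
      ∑ i, ∑ j, (ħ / 2 * (CFC.sqrt B k i * CFC.sqrt B k j)) *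
        (ladderProd n i t * ladderProd n j t) := by
    rw [mul_pow, hs, sq (∑ j, _), Finset.sum_mul_sum]
    simp only [Finset.mul_sum]
    exact Finset.sum_congr rfl fun i _ => Finset.sum_congr rfl fun j _ => by ring
  have i1 : Integrable fun t => ((p k ^ 2 * (hermiteProd n t * hermiteProd n t) +
      ∑ j, (2 * p k * Real.sqrt (ħ / 2) * (A * invSqrt B) k j) *
        (positionProd n j t * hermiteProd n t)) +
      ∑ i, ∑ j, (ħ / 2 * ((A * invSqrt B) k i * (A * invSqrt B) k j)) *
        (positionProd n i t * positionProd n j t)) * weight t := by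
    have i1 : Integrable fun t => (p k ^ 2 * (hermiteProd n t * hermiteProd n t)) * weight t := by
      simp only [mul_assoc (p k ^ 2)]
      exact (integrable_prodEval_mul_prodEval _ _).const_mul _
    simp only [add_mul]
    exact (i1.add (integrable_linear _ _ _)).add (integrable_quadratic _ _)
  have i2 : Integrable fun t => (∑ i, ∑ j, (ħ / 2 * (CFC.sqrt B k i * CFC.sqrt B k j)) *
      (ladderProd n i t * ladderProd n j t)) * weight t := integrable_quadratic _ _
  simp only [e1, e2]
  rw [gaussMean_add i1 i2, mul_add, packetNorm_sq_mul_gaussMean,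
    packetNorm_sq_mul_gaussMean_ladder, add_assoc, ← Finset.sum_add_distrib, Finset.mul_sum]
  congr 1
  exact Finset.sum_congr rfl fun j _ => by ring

theorem inv_Bn (n : Fin d → ℕ) : (Bn B n)⁻¹ = invSqrt B * Lam n * invSqrt B := by
  have h : IsUnit (Lam n).det := by
    rw [Lam, Matrix.det_diagonal]
    exact isUnit_iff_ne_zero.mpr (Finset.prod_ne_zero_iff.mpr fun j _ => by positivity)
  rw [Bn, Matrix.mul_inv_rev, Matrix.mul_inv_rev, Matrix.nonsing_inv_nonsing_inv _ h, invSqrt,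
    mul_assoc]

/-- Cyclicity of the trace, applied to (B⁽ⁿ⁾)⁻¹ = B^{-1/2} Λ⁽ⁿ⁾ B^{-1/2}. It turns the diagonal sums
of both energies into the traces of the theorem. -/
theorem trace_inv_Bn_mul (n : Fin d → ℕ) (M : Matrix (Fin d) (Fin d) ℝ) :
    ((Bn B n)⁻¹ * M).trace = ∑ j, (invSqrt B * M * invSqrt B) j j * (2 * n j + 1) := by
  rw [inv_Bn, mul_assoc, mul_assoc, Matrix.trace_mul_comm, mul_assoc, mul_assoc,
    Matrix.trace_mul_comm, Lam, Matrix.trace]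
  simp only [Matrix.diag_apply, ← mul_assoc, Matrix.mul_diagonal]

theorem kineticPart_eq (hA : A.IsSymm) (hB : B.PosDef) (m : ℝ) (n : Fin d → ℕ) :
    1 / (2 * m) * ∑ k, (p k ^ 2 + ħ / 2 *
      ∑ j, ((A * invSqrt B) k j ^ 2 + CFC.sqrt B k j ^ 2) * (2 * n j + 1)) =
    kineticPart ħ m p A B n := by
  -- Writing the conjugated matrix as a sum of Gram matrices makes its diagonal entries the column
  -- sums of squares of A B^{-1/2} and B^{1/2}.
  have h1 : invSqrt B * (A ^ 2 + B ^ 2) * invSqrt B =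
      (A * invSqrt B).transpose * (A * invSqrt B) + (CFC.sqrt B).transpose * CFC.sqrt B := by
    rw [Matrix.transpose_mul, hA.eq, (invSqrt_isSymm B).eq, (sqrt_isSymm B).eq, mul_add, add_mul]
    congr 1
    · simp only [sq, mul_assoc]
    · rw [sq, ← mul_assoc, invSqrt_mul hB, mul_assoc, mul_invSqrt hB]
  have h2 (j : Fin d) : (invSqrt B * (A ^ 2 + B ^ 2) * invSqrt B) j j =
      ∑ k, ((A * invSqrt B) k j ^ 2 + CFC.sqrt B k j ^ 2) := by
    rw [h1, Matrix.add_apply, Matrix.mul_apply, Matrix.mul_apply, ← Finset.sum_add_distrib]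
    exact Finset.sum_congr rfl fun k _ => by simp only [Matrix.transpose_apply, sq]
  rw [kineticPart, trace_inv_Bn_mul, EuclideanSpace.real_norm_sq_eq, Finset.sum_add_distrib,
    ← Finset.mul_sum, Finset.sum_comm]
  simp only [h2, Finset.sum_mul]
  ring

theorem innerL2_wavePacket_kineticOp (hA : A.IsSymm) (hB : B.PosDef) (hħ : 0 < ħ) (m : ℝ)
    (n : Fin d → ℕ) :
    innerL2 (wavePacket ħ q p A B φ δ n) (kineticOp ħ m (wavePacket ħ q p A B φ δ n)) =
      ((normSq ħ B δ * kineticPart ħ m p A B n : ℝ) : ℂ) := by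
  rw [innerL2_kineticOp hA hB hħ m (isPacket_wavePacket hA hB hħ n)]
  simp only [integral_norm_momentumOp_sq hA hB hħ, ← Finset.mul_sum]
  rw [mul_left_comm, kineticPart_eq hA hB]

end Kinetic

/-! ### The potential energy of a wave packet -/

section Taylor

variable {d : ℕ} {V : Space d → ℝ} {C₂ M₁ : ℝ}

theorem sum_smul_e (y : Space d) : ∑ k, y k • e k = y := by
  simpa [e] using (EuclideanSpace.basisFun (Fin d) ℝ).sum_repr y

/-- Multilinear expansion of y in the standard basis gives d³ terms, each at most ‖y‖³ b. -/
theorem abs_iteratedFDeriv_three_le {x : Space d} {b : ℝ}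
    (h : ∀ α : Fin 3 → Fin d, |iteratedFDeriv ℝ 3 V x (fun i => e (α i))| ≤ b) (y : Space d) :
    |iteratedFDeriv ℝ 3 V x (fun _ => y)| ≤ d ^ 3 * ‖y‖ ^ 3 * b := by
  have h1 : iteratedFDeriv ℝ 3 V x (fun _ => y) =
      ∑ α : Fin 3 → Fin d, (∏ i, y (α i)) * iteratedFDeriv ℝ 3 V x (fun i => e (α i)) := by
    conv_lhs => rw [← sum_smul_e y]
    rw [ContinuousMultilinearMap.map_sum]
    exact Finset.sum_congr rfl fun α _ =>
      (iteratedFDeriv ℝ 3 V x).map_smul_univ (fun i => y (α i)) (fun i => e (α i))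
  have h2 (α : Fin 3 → Fin d) : |(∏ i, y (α i)) * iteratedFDeriv ℝ 3 V x (fun i => e (α i))| ≤
      ‖y‖ ^ 3 * b := by
    rw [abs_mul, Finset.abs_prod]
    refine mul_le_mul ?_ (h α) (abs_nonneg _) (by positivity)
    calc ∏ i, |y (α i)| ≤ ∏ _i : Fin 3, ‖y‖ :=
          Finset.prod_le_prod (fun _ _ => abs_nonneg _) fun i _ => PiLp.norm_apply_le y (α i)
      _ = ‖y‖ ^ 3 := by simp
  rw [h1]
  refine (Finset.abs_sum_le_sum_abs _ _).trans ((Finset.sum_le_sum fun α _ => h2 α).trans ?_)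
  simp [mul_assoc]

/-- Taylor's formula of second order, with a remainder controlled by the third derivatives. -/
theorem abs_taylor_remainder_le (hV : ContDiff ℝ 3 V)
    (hV3 : ∀ (x : Space d) (α : Fin 3 → Fin d),
      |iteratedFDeriv ℝ 3 V x (fun i => e (α i))| ≤ C₂ * Real.exp (M₁ * ‖x‖ ^ 2)) (q x : Space d) :
    |V x - (V q + fderiv ℝ V q (x - q) + 1 / 2 * fderiv ℝ (fderiv ℝ V) q (x - q) (x - q))| ≤
      (1 / 2 * d ^ 3 * (|C₂| * Real.exp (2 * |M₁| * ‖q‖ ^ 2))) *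
        (‖x - q‖ ^ 3 * Real.exp (2 * |M₁| * ‖x - q‖ ^ 2)) := by
  set y := x - q with hy
  have h := map_add_eq_sum_add_integral_iteratedFDeriv (f := V) (x := q) (y := y) (n := 2)
    (fun t _ => by simpa using! hV.contDiffAt (x := q + t • y))
  have hx : q + y = x := by rw [hy]; abel
  rw [hx] at h
  have hI : ‖∫ t in (0 : ℝ)..1, (1 - t) ^ 2 • iteratedFDeriv ℝ (2 + 1) V (q + t • y) (fun _ => y)‖ ≤
      d ^ 3 * ‖y‖ ^ 3 * (|C₂| * Real.exp (2 * |M₁| * ‖q‖ ^ 2) *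
        Real.exp (2 * |M₁| * ‖y‖ ^ 2)) * |1 - 0| := by
    refine intervalIntegral.norm_integral_le_of_norm_le_const fun t ht => ?_
    rw [Set.uIoc_of_le zero_le_one] at ht
    rw [norm_smul, Real.norm_eq_abs, Real.norm_eq_abs]
    have h1 : |(1 - t) ^ 2| ≤ 1 := by
      rw [abs_of_nonneg (sq_nonneg _)]
      nlinarith [ht.1, ht.2]
    refine (mul_le_of_le_one_left (abs_nonneg _) h1).trans ?_
    refine abs_iteratedFDeriv_three_le (fun α => (hV3 _ α).trans ?_) y
    -- This separates q from y in the exponent and is the origin of the factors 2|M₁|; the absolute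
    -- value allows M₁ of either sign.
    have h2 : ‖q + t • y‖ ^ 2 ≤ 2 * ‖q‖ ^ 2 + 2 * ‖y‖ ^ 2 := by
      have h3 : ‖q + t • y‖ ≤ ‖q‖ + ‖y‖ := by
        refine (norm_add_le _ _).trans ?_
        rw [norm_smul, Real.norm_eq_abs, abs_of_pos ht.1]
        nlinarith [ht.2, norm_nonneg y]
      nlinarith [norm_nonneg (q + t • y), sq_nonneg (‖q‖ - ‖y‖)]
    rw [mul_assoc |C₂|, ← Real.exp_add]
    refine mul_le_mul (le_abs_self _) (Real.exp_le_exp.mpr ?_) (Real.exp_pos _).le (abs_nonneg _)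
    calc M₁ * ‖q + t • y‖ ^ 2 ≤ |M₁| * ‖q + t • y‖ ^ 2 :=
          mul_le_mul_of_nonneg_right (le_abs_self _) (sq_nonneg _)
      _ ≤ |M₁| * (2 * ‖q‖ ^ 2 + 2 * ‖y‖ ^ 2) := mul_le_mul_of_nonneg_left h2 (abs_nonneg _)
      _ = _ := by ring
  rw [h]
  simp only [Finset.sum_range_succ, Finset.sum_range_zero, iteratedFDeriv_zero_apply,
    iteratedFDeriv_one_apply, iteratedFDeriv_two_apply, Nat.factorial, smul_eq_mul]
  rw [Real.norm_eq_abs] at hI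
  simp only [smul_eq_mul] at hI
  norm_num at hI ⊢
  linarith

end Taylor

/-! ### Expectation of the Taylor polynomial and of its remainder -/

section Potential

variable {d : ℕ} {ħ : ℝ} {q p : Space d} {A B : Matrix (Fin d) (Fin d) ℝ} {φ δ : ℝ}
  {V : Space d → ℝ} {C₂ M₁ : ℝ}

/-- The second-order Taylor polynomial of `V` in the normalized coordinates. -/
def taylorQuadratic (ħ : ℝ) (V : Space d → ℝ) (q : Space d) (B : Matrix (Fin d) (Fin d) ℝ)
    (t : Fin d → ℝ) : ℝ :=
  V q + ∑ j, (Real.sqrt (ħ / 2) * ∑ k, fderiv ℝ V q (e k) * invSqrt B k j) * t j +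
    ∑ i, ∑ j, (ħ / 4 * (invSqrt B * hessian V q * invSqrt B) i j) * (t i * t j)

/-- Substitute x - q = (ħ/2)^{1/2} B^{-1/2} t; the coefficient ħ/4 is 1/2 from Taylor times ħ/2 from
the two coordinates. -/
theorem taylorQuadratic_coord (hB : B.PosDef) (hħ : 0 < ħ) (V : Space d → ℝ) (q x : Space d) :
    taylorQuadratic ħ V q B (coord ħ q B x) =
      V q + fderiv ℝ V q (x - q) + 1 / 2 * fderiv ℝ (fderiv ℝ V) q (x - q) (x - q) := by
  set u : Fin d → ℝ := fun k => x k - q k with hu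
  have h0 : x - q = ∑ k, u k • e k := (sum_smul_e (x - q)).symm
  have hs : Real.sqrt (ħ / 2) * Real.sqrt (ħ / 2) = ħ / 2 := Real.mul_self_sqrt (by positivity)
  have h1 : fderiv ℝ V q (x - q) =
      ∑ j, (Real.sqrt (ħ / 2) * ∑ k, fderiv ℝ V q (e k) * invSqrt B k j) * coord ħ q B x j := by
    rw [h0, map_sum]
    simp only [map_smul, smul_eq_mul, hu, sub_eq_sum_coord hB hħ q x, Finset.mul_sum,
      Finset.sum_mul]
    rw [Finset.sum_comm]
    exact Finset.sum_congr rfl fun j _ => Finset.sum_congr rfl fun k _ => by ring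
  have h2 : fderiv ℝ (fderiv ℝ V) q (x - q) (x - q) =
      ∑ k, ∑ l, hessian V q k l * (u k * u l) := by
    have hh (k l : Fin d) : hessian V q k l = fderiv ℝ (fderiv ℝ V) q (e k) (e l) := by
      simp [hessian, iteratedFDeriv_two_apply]
    rw [h0]
    simp only [map_sum, map_smul, sum_apply, smul_apply, smul_eq_mul, hh, Finset.mul_sum]
    rw [Finset.sum_comm]
    exact Finset.sum_congr rfl fun k _ => Finset.sum_congr rfl fun l _ => by ring
  have h3 : ∑ k, ∑ l, hessian V q k l * (u k * u l) = ħ / 2 *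
      ∑ i, ∑ j, (invSqrt B * hessian V q * invSqrt B) i j *
        (coord ħ q B x i * coord ħ q B x j) := by
    have e1 : ∑ k, ∑ l, hessian V q k l * (u k * u l) =
        ∑ k, u k * ∑ l, hessian V q k l * (x l - q l) := by
      simp only [Finset.mul_sum]
      exact Finset.sum_congr rfl fun k _ => Finset.sum_congr rfl fun l _ => by ring
    have e2 (j : Fin d) : ∑ k, u k * (hessian V q * invSqrt B) k j =
        Real.sqrt (ħ / 2) * ∑ i, coord ħ q B x i * (invSqrt B * hessian V q * invSqrt B) i j := by
      have e0 (i : Fin d) : (invSqrt B * hessian V q * invSqrt B) i j =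
          ∑ k, invSqrt B i k * (hessian V q * invSqrt B) k j := by
        rw [mul_assoc, Matrix.mul_apply]
      simp only [e0, hu, sub_eq_sum_coord hB hħ q x, Finset.mul_sum, Finset.sum_mul]
      rw [Finset.sum_comm]
      refine Finset.sum_congr rfl fun i _ => Finset.sum_congr rfl fun k _ => ?_
      rw [(invSqrt_isSymm B).apply i k]
      ring
    have e3 : ∑ k, u k * ∑ l, hessian V q k l * (x l - q l) = Real.sqrt (ħ / 2) *
        ∑ j, (∑ k, u k * (hessian V q * invSqrt B) k j) * coord ħ q B x j := by
      simp only [sum_mul_sub_eq hB hħ, Finset.mul_sum, Finset.sum_mul]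
      rw [Finset.sum_comm]
      exact Finset.sum_congr rfl fun j _ => Finset.sum_congr rfl fun k _ => by ring
    have e4 : ∑ j, (∑ k, u k * (hessian V q * invSqrt B) k j) * coord ħ q B x j =
        Real.sqrt (ħ / 2) * ∑ i, ∑ j, (invSqrt B * hessian V q * invSqrt B) i j *
          (coord ħ q B x i * coord ħ q B x j) := by
      simp only [e2, Finset.mul_sum, Finset.sum_mul]
      rw [Finset.sum_comm]
      exact Finset.sum_congr rfl fun j _ => Finset.sum_congr rfl fun k _ => by ring
    rw [e1, e3, e4, ← mul_assoc, hs]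
  rw [taylorQuadratic, h1, h2, h3]
  simp only [mul_assoc (ħ / 4), ← Finset.mul_sum]
  ring

theorem hasTemperateGrowth_taylorQuadratic (ħ : ℝ) (V : Space d → ℝ) (q : Space d)
    (B : Matrix (Fin d) (Fin d) ℝ) :
    Function.HasTemperateGrowth fun x => taylorQuadratic ħ V q B (coord ħ q B x) := by
  have h := hasTemperateGrowth_coord ħ q B
  unfold taylorQuadratic
  fun_prop

theorem abs_sub_taylorQuadratic_le (hB : B.PosDef) (hV : ContDiff ℝ 3 V)
    (hV3 : ∀ (x : Space d) (α : Fin 3 → Fin d),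
      |iteratedFDeriv ℝ 3 V x (fun i => e (α i))| ≤ C₂ * Real.exp (M₁ * ‖x‖ ^ 2)) (q : Space d) :
    ∃ K ħ₀ : ℝ, 0 < ħ₀ ∧ ∀ ħ, 0 < ħ → ħ < ħ₀ → ∀ x,
      |V x - taylorQuadratic ħ V q B (coord ħ q B x)| ≤
        K * ħ ^ (3 / 2 : ℝ) * Real.exp (1 / 8 * ∑ j, coord ħ q B x j ^ 2) := by
  have hκ := spread_nonneg B
  set K₀ : ℝ := 1 / 2 * d ^ 3 * (|C₂| * Real.exp (2 * |M₁| * ‖q‖ ^ 2))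
  have hK₀ : 0 ≤ K₀ := by positivity
  -- The exponent 1/8 is shared equally. One 1/16 absorbs |t|³, by `add_pow_le_mul_exp_sq` with a =
  -- 0, k = 3, ε = 1/16; the other absorbs exp(2|M₁|‖x - q‖²), since the choice of ħ₀ ensures |M₁|
  -- `spread B` ħ ≤ 1/16.
  refine ⟨K₀ * (Real.sqrt (spread B / 2) ^ 3 * Real.exp (3 * 0 + 3 ^ 2 / (4 * (1 / 16)))),
    1 / (16 * (|M₁| * spread B + 1)), by positivity, fun ħ hħ hħ₀ x => ?_⟩
  set T : ℝ := ∑ j, coord ħ q B x j ^ 2 with hT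
  have hT0 : 0 ≤ T := Finset.sum_nonneg fun _ _ => sq_nonneg _
  have hu := norm_sub_sq_le hB hħ q x
  rw [← hT] at hu
  rw [taylorQuadratic_coord hB hħ]
  refine (abs_taylor_remainder_le hV hV3 q x).trans ?_
  have h1 : ‖x - q‖ ≤ Real.sqrt ħ * (Real.sqrt (spread B / 2) * Real.sqrt T) := by
    rw [← Real.sqrt_mul (by positivity), ← Real.sqrt_mul (by positivity)]
    refine Real.le_sqrt_of_sq_le (hu.trans (le_of_eq ?_))
    ring
  have h2 : ‖x - q‖ ^ 3 ≤ ħ ^ (3 / 2 : ℝ) * (Real.sqrt (spread B / 2) ^ 3 *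
      (Real.exp (3 * 0 + 3 ^ 2 / (4 * (1 / 16))) * Real.exp (1 / 16 * T))) := by
    have h3 : Real.sqrt ħ ^ 3 = ħ ^ (3 / 2 : ℝ) := by
      rw [Real.sqrt_eq_rpow, ← Real.rpow_mul_natCast hħ.le]
      norm_num
    have h4 := add_pow_le_mul_exp_sq (le_refl (0 : ℝ)) 3 (ε := 1 / 16) (by norm_num)
      (Real.sqrt_nonneg T)
    rw [zero_add, Real.sq_sqrt hT0] at h4
    push_cast at h4
    refine (pow_le_pow_left₀ (norm_nonneg _) h1 3).trans ?_
    rw [mul_pow, mul_pow, h3]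
    gcongr
  have h5 : Real.exp (2 * |M₁| * ‖x - q‖ ^ 2) ≤ Real.exp (1 / 16 * T) := by
    refine Real.exp_le_exp.mpr ?_
    have h6 : ħ * (16 * (|M₁| * spread B + 1)) < 1 := by
      rwa [lt_div_iff₀ (by positivity)] at hħ₀
    calc 2 * |M₁| * ‖x - q‖ ^ 2 ≤ 2 * |M₁| * (ħ / 2 * spread B * T) := by gcongr
      _ = (|M₁| * spread B * ħ) * T := by ring
      _ ≤ 1 / 16 * T := by
        refine mul_le_mul_of_nonneg_right ?_ hT0
        nlinarith
  calc K₀ * (‖x - q‖ ^ 3 * Real.exp (2 * |M₁| * ‖x - q‖ ^ 2))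
      ≤ K₀ * ((ħ ^ (3 / 2 : ℝ) * (Real.sqrt (spread B / 2) ^ 3 *
      (Real.exp (3 * 0 + 3 ^ 2 / (4 * (1 / 16))) * Real.exp (1 / 16 * T)))) *
        Real.exp (1 / 16 * T)) := by gcongr
    _ = _ := by
      have h7 : Real.exp (1 / 8 * T) = Real.exp (1 / 16 * T) * Real.exp (1 / 16 * T) := by
        rw [← Real.exp_add]
        ring_nf
      rw [h7]
      ring

theorem norm_wavePacket_sq (hA : A.IsSymm) (hB : B.PosDef) (hħ : 0 < ħ) (n : Fin d → ℕ)
    (x : Space d) :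
    ‖wavePacket ħ q p A B φ δ n x‖ ^ 2 =
      packetNorm n ^ 2 * hermiteProd n (coord ħ q B x) ^ 2 * ‖gaussian ħ q p A B φ δ x‖ ^ 2 := by
  rw [wavePacket_eq hA hB hħ n, norm_mul, mul_pow, Complex.norm_real, Real.norm_eq_abs, sq_abs,
    mul_pow]

theorem integrable_exp_mul_hermiteProd_sq (n : Fin d → ℕ) :
    Integrable fun t : Fin d → ℝ =>
      Real.exp (1 / 8 * ∑ j, t j ^ 2) * hermiteProd n t ^ 2 * weight t := by
  -- The combined Gaussian exponent is 1/8 - 1/2 = -3/8.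
  have h := Integrable.fintype_prod (f := fun i : Fin d => fun s : ℝ =>
    (hermiteR (n i) ^ 2).eval s * Real.exp (-(3 / 8) * s ^ 2))
      (fun i => integrable_polynomial_mul_exp (hermiteR (n i) ^ 2) (by norm_num))
  refine h.congr (Filter.Eventually.of_forall fun t => ?_)
  simp only [Polynomial.eval_pow, Finset.prod_mul_distrib, Finset.prod_pow, hermiteProd, prodEval,
    ← Real.exp_sum, weight, ← Finset.mul_sum]
  rw [mul_right_comm, ← Real.exp_add, mul_comm]
  congr 2
  ring

theorem integral_taylorQuadratic_mul (hA : A.IsSymm) (hB : B.PosDef) (hħ : 0 < ħ)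
    (V : Space d → ℝ) (n : Fin d → ℕ) :
    Integrable (fun x => taylorQuadratic ħ V q B (coord ħ q B x) *
        ‖wavePacket ħ q p A B φ δ n x‖ ^ 2) ∧
    ∫ x, taylorQuadratic ħ V q B (coord ħ q B x) * ‖wavePacket ħ q p A B φ δ n x‖ ^ 2 =
      normSq ħ B δ * (V q + ħ / 4 * ((Bn B n)⁻¹ * hessian V q).trace) := by
  set b : Fin d → ℝ := fun j => Real.sqrt (ħ / 2) * ∑ k, fderiv ℝ V q (e k) * invSqrt B k j with hb
  set a : Fin d → Fin d → ℝ := fun i j =>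
    ħ / 4 * (invSqrt B * hessian V q * invSqrt B) i j with ha
  set F : (Fin d → ℝ) → ℝ := fun t => packetNorm n ^ 2 *
      ((V q * (hermiteProd n t * hermiteProd n t) +
      ∑ j, b j * (positionProd n j t * hermiteProd n t)) +
      ∑ i, ∑ j, a i j * (positionProd n i t * positionProd n j t)) with hF
  have h1 (x : Space d) : taylorQuadratic ħ V q B (coord ħ q B x) *
      ‖wavePacket ħ q p A B φ δ n x‖ ^ 2 =
      F (coord ħ q B x) * ‖gaussian ħ q p A B φ δ x‖ ^ 2 := by
    have h0 (t : Fin d → ℝ) : taylorQuadratic ħ V q B t =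
      V q + ∑ j, b j * t j + ∑ i, ∑ j, a i j * (t i * t j) := rfl
    rw [norm_wavePacket_sq hA hB hħ, ← mul_assoc]
    congr 1
    simp only [hF, h0, positionProd_eq, add_mul, mul_add, Finset.sum_mul,
      Finset.mul_sum]
    congr 1
    · congr 1
      · ring
      · exact Finset.sum_congr rfl fun j _ => by ring
    · exact Finset.sum_congr rfl fun i _ => Finset.sum_congr rfl fun j _ => by ring
  simp only [h1]
  constructor
  · refine integrable_mul_norm_gaussian_sq hB hħ q p A φ δ ?_
    have i1 : Integrable fun t => (V q * (hermiteProd n t * hermiteProd n t)) * weight t := by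
      simp only [mul_assoc (V q)]
      exact (integrable_prodEval_mul_prodEval _ _).const_mul _
    have i2 : Integrable fun t =>
        (∑ j, b j * (positionProd n j t * hermiteProd n t)) * weight t := integrable_linear _ _ b
    have i3 : Integrable fun t =>
        (∑ i, ∑ j, a i j * (positionProd n i t * positionProd n j t)) * weight t :=
      integrable_quadratic _ a
    simp only [hF, mul_assoc (packetNorm n ^ 2), add_mul]
    exact ((i1.add i2).add i3).const_mul _
  · rw [integral_mul_norm_gaussian_sq hB hħ, hF, gaussMean_const_mul, packetNorm_sq_mul_gaussMean,
      trace_inv_Bn_mul, Finset.mul_sum]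
    simp only [ha, mul_assoc]

theorem memLp_potential_mul (hA : A.IsSymm) (hB : B.PosDef) (hħ : 0 < ħ) (hV : Continuous V)
    (n : Fin d → ℕ) {K : ℝ}
    (hR : ∀ x, |V x - taylorQuadratic ħ V q B (coord ħ q B x)| ≤
      K * Real.exp (1 / 8 * ∑ j, coord ħ q B x j ^ 2)) :
    MemLp (fun x => (V x : ℂ) * wavePacket ħ q p A B φ δ n x) 2 volume := by
  obtain ⟨c₁, hc₁, h1⟩ := norm_le_exp_coord hB hħ q
    (hasTemperateGrowth_taylorQuadratic ħ V q B) (ε := 1 / 8) (by norm_num)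
  have hG : Function.HasTemperateGrowth fun x => packetNorm n * hermiteProd n (coord ħ q B x) :=
    (Function.HasTemperateGrowth.const _).mul (hasTemperateGrowth_prodEval_coord ħ q B _)
  obtain ⟨c₂, hc₂, h2⟩ := norm_le_exp_coord hB hħ q hG (ε := 1 / 16) (by norm_num)
  rw [wavePacket_eq hA hB hħ n]
  simp only [← mul_assoc, ← Complex.ofReal_mul]
  -- The potential costs 1/8 and the Hermite factor 1/16, in total 3/16 < 1/4.
  refine memLp_mul_gaussian hB hħ (C := (c₁ + K) * c₂) (a := 3 / 16)
    (Complex.continuous_ofReal.comp ?_) (by norm_num) fun x => ?_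
  · have hc : Continuous fun x => V x * (packetNorm n * hermiteProd n (coord ħ q B x)) :=
      hV.mul hG.1.continuous
    simpa only [mul_assoc] using hc
  · rw [Complex.norm_real, mul_assoc, norm_mul]
    have h3 : ‖V x‖ ≤ (c₁ + K) * Real.exp (1 / 8 * ∑ j, coord ħ q B x j ^ 2) := by
      have h4 := norm_add_le (taylorQuadratic ħ V q B (coord ħ q B x))
        (V x - taylorQuadratic ħ V q B (coord ħ q B x))
      rw [add_sub_cancel] at h4
      have h5 := hR x
      rw [← Real.norm_eq_abs] at h5
      linarith [h1 x]
    refine (mul_le_mul h3 (h2 x) (norm_nonneg _) ((norm_nonneg _).trans h3)).trans (le_of_eq ?_)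
    rw [mul_mul_mul_comm, ← Real.exp_add]
    congr 2
    ring

theorem potential_expectation (hB : B.PosDef) (hA : A.IsSymm) (hV : ContDiff ℝ 3 V)
    (hV3 : ∀ (x : Space d) (α : Fin 3 → Fin d),
      |iteratedFDeriv ℝ 3 V x (fun i => e (α i))| ≤ C₂ * Real.exp (M₁ * ‖x‖ ^ 2))
    (n : Fin d → ℕ) (q p : Space d) :
    ∃ K ħ₀ : ℝ, 0 < ħ₀ ∧ ∀ φ δ ħ : ℝ, 0 < ħ → ħ < ħ₀ →
      MemLp (fun x => (V x : ℂ) * wavePacket ħ q p A B φ δ n x) 2 volume ∧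
      |(∫ x, V x * ‖wavePacket ħ q p A B φ δ n x‖ ^ 2) -
        normSq ħ B δ * (V q + ħ / 4 * ((Bn B n)⁻¹ * hessian V q).trace)| ≤
      K * (normSq ħ B δ * ħ ^ (3 / 2 : ℝ)) := by
  obtain ⟨K, ħ₀, hħ₀, h⟩ := abs_sub_taylorQuadratic_le hB hV hV3 q
  -- The mean of exp(|t|²/8) in the Hermite state is taken in the t variables, so the constant is
  -- free of ħ, φ and δ.
  refine ⟨K * (packetNorm n ^ 2 * gaussMean fun t : Fin d → ℝ =>
    Real.exp (1 / 8 * ∑ j, t j ^ 2) * hermiteProd n t ^ 2), ħ₀, hħ₀, fun φ δ ħ hħ hlt => ?_⟩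
  have hL := memLp_potential_mul (p := p) (φ := φ) (δ := δ) hA hB hħ hV.continuous n (h ħ hħ hlt)
  refine ⟨hL, ?_⟩
  obtain ⟨i1, e1⟩ := integral_taylorQuadratic_mul (q := q) (p := p) (φ := φ) (δ := δ) hA hB hħ V n
  -- V|χₙ|² is the real part of the product of conj χₙ and Vχₙ, both in L².
  have i2 : Integrable fun x => V x * ‖wavePacket ħ q p A B φ δ n x‖ ^ 2 := by
    have h1 := (integrable_conj_mul ((isPacket_wavePacket (q := q) (p := p) (φ := φ) (δ := δ)
      hA hB hħ n).memLp hB hħ) hL).re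
    refine h1.congr (Filter.Eventually.of_forall fun x => ?_)
    simp only [mul_left_comm _ (V x : ℂ), Complex.conj_mul', ← Complex.ofReal_pow,
      ← Complex.ofReal_mul]
    exact Complex.ofReal_re _
  have i3 := (integrable_mul_norm_gaussian_sq hB hħ q p A φ δ
    (integrable_exp_mul_hermiteProd_sq n)).const_mul (K * ħ ^ (3 / 2 : ℝ) * packetNorm n ^ 2)
  rw [← e1, ← integral_sub i2 i1, ← Real.norm_eq_abs]
  refine (norm_integral_le_of_norm_le i3 (Filter.Eventually.of_forall fun x => ?_)).trans
    (le_of_eq ?_)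
  · rw [← sub_mul, norm_mul, norm_pow, norm_norm, Real.norm_eq_abs, norm_wavePacket_sq hA hB hħ]
    refine (mul_le_mul_of_nonneg_right (h ħ hħ hlt x) (by positivity)).trans (le_of_eq ?_)
    ring
  · rw [integral_const_mul, integral_mul_norm_gaussian_sq hB hħ q p A φ δ
      (fun t : Fin d → ℝ => Real.exp (1 / 8 * ∑ j, t j ^ 2) * hermiteProd n t ^ 2)]
    ring

end Potential

end

end Semiclassical

/-! ### The expectation of the energy -/

theorem mainTheorem2 {d : ℕ} (m : ℝ) (hm : 0 < m)
    (V : Semiclassical.Space d → ℝ) (hV : ContDiff ℝ 3 V)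
    (C₁ C₂ M₁ : ℝ) (hV_below : ∀ x, C₁ ≤ V x)
    (hV_third : ∀ (x : Semiclassical.Space d) (α : Fin 3 → Fin d),
      |iteratedFDeriv ℝ 3 V x (fun i => Semiclassical.e (α i))| ≤ C₂ * Real.exp (M₁ * ‖x‖ ^ 2))
    (n : Fin d → ℕ) (q p : Semiclassical.Space d)
    (A B : Matrix (Fin d) (Fin d) ℝ) (hA : A.IsSymm) (hB : B.PosDef) :
    (∀ φ δ ħ : ℝ, 0 < ħ →
      MemLp (Semiclassical.wavePacket ħ q p A B φ δ n) 2 volume ∧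
      MemLp (Semiclassical.kineticOp ħ m (Semiclassical.wavePacket ħ q p A B φ δ n)) 2 volume ∧
      Semiclassical.innerL2 (Semiclassical.wavePacket ħ q p A B φ δ n)
          (Semiclassical.kineticOp ħ m (Semiclassical.wavePacket ħ q p A B φ δ n)) =
        ((Semiclassical.normSq ħ B δ * Semiclassical.kineticPart ħ m p A B n : ℝ) : ℂ)) ∧
    ∃ K ħ₀ : ℝ, 0 < ħ₀ ∧ ∀ φ δ ħ : ℝ, 0 < ħ → ħ < ħ₀ →
      MemLp (Semiclassical.schrodingerOp ħ m V (Semiclassical.wavePacket ħ q p A B φ δ n)) 2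
        volume ∧
      ‖Semiclassical.innerL2 (Semiclassical.wavePacket ħ q p A B φ δ n)
          (Semiclassical.schrodingerOp ħ m V (Semiclassical.wavePacket ħ q p A B φ δ n)) -
        ((Semiclassical.hamiltonian ħ m V n q p A B δ : ℝ) : ℂ)‖ ≤
      K * (Semiclassical.normSq ħ B δ * ħ ^ (3 / 2 : ℝ)) := by
  have hP (φ δ ħ : ℝ) (hħ : 0 < ħ) := Semiclassical.isPacket_wavePacket (q := q) (p := p) (φ := φ)
    (δ := δ) hA hB hħ n
  have hT (φ δ ħ : ℝ) (hħ : 0 < ħ) :=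
    (hP φ δ ħ hħ).memLp_kineticOp hA hB hħ m
  refine ⟨fun φ δ ħ hħ => ⟨(hP φ δ ħ hħ).memLp hB hħ, hT φ δ ħ hħ,
    Semiclassical.innerL2_wavePacket_kineticOp hA hB hħ m n⟩, ?_⟩
  obtain ⟨K, ħ₀, hħ₀, h⟩ := Semiclassical.potential_expectation hB hA hV hV_third n q p
  refine ⟨K, ħ₀, hħ₀, fun φ δ ħ hħ hlt => ?_⟩
  obtain ⟨hL, hK⟩ := h φ δ ħ hħ hlt
  have hχ := (hP φ δ ħ hħ).memLp hB hħ
  refine ⟨(hT φ δ ħ hħ).add hL, ?_⟩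
  -- The kinetic contribution is exact, so after this splitting the whole error is the potential
  -- one.
  have h1 : Semiclassical.innerL2 (Semiclassical.wavePacket ħ q p A B φ δ n)
      (Semiclassical.schrodingerOp ħ m V (Semiclassical.wavePacket ħ q p A B φ δ n)) =
      Semiclassical.innerL2 (Semiclassical.wavePacket ħ q p A B φ δ n)
        (Semiclassical.kineticOp ħ m (Semiclassical.wavePacket ħ q p A B φ δ n)) +
      ((∫ x, V x * ‖Semiclassical.wavePacket ħ q p A B φ δ n x‖ ^ 2 : ℝ) : ℂ) := by
    simp only [Semiclassical.innerL2, Semiclassical.schrodingerOp, mul_add]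
    rw [integral_add (Semiclassical.integrable_conj_mul hχ (hT φ δ ħ hħ))
      (Semiclassical.integrable_conj_mul hχ hL), ← integral_complex_ofReal]
    congr 2
    funext x
    rw [mul_left_comm, Complex.conj_mul', Complex.ofReal_mul, Complex.ofReal_pow]
  rw [h1, Semiclassical.innerL2_wavePacket_kineticOp hA hB hħ m n, ← Complex.ofReal_add,
    ← Complex.ofReal_sub, Complex.norm_real, Real.norm_eq_abs]
  refine le_trans (le_of_eq ?_) hK
  congr 1
  rw [Semiclassical.hamiltonian]
  ring
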